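/- **Setting.** For a closed bounded convex set $K\subset\mathbb R^d$ with $0$ in its interior let $\gamma_K(x)=\inf\{c>0: x\in cK\}$ be its gauge and $\|y\|_*=\max_{u\in K}\langle y,u\rangle$ the dual of the gauge. A differentiable $h:\mathbb R^d\to\mathbb R$ is $L$-smooth w.r.t. $\gamma_K$ if $\|\nabla h(x)-\nabla h(z)\|_*\le L\,\gamma_K(x-z)$ for all $x,z\in\mathbb R^d$. For $\lambda>0$, $K$ is a $\lambda$-Gauge set if it is as above and $\frac\lambda2$-strongly convex w.r.t. its gauge: for all $x,z\in K$, $\theta\in[0,1]$, the gauge ball $\{y:\gamma_K(y-\theta x-(1-\theta)z)\le\theta(1-\theta)\frac{\lambda}{4}\gamma_K(x-z)^2\}$ is contained in $K$. Let $\lambda,L_\phi,L,\mu>0$, let $K$ be a $\lambda$-Gauge set such that $\gamma_K^2$ is differentiable and $L_\phi$-smooth w.r.t. $\gamma_K$, and put $\phi=\frac1\lambda\gamma_K^2$. Let $f$ be $L$-smooth w.r.t. $\gamma_K$ and $\mu$-strongly convex on $K$ relative to $\phi$: for all $x,z\in K$, $f(z)\ge f(x)+\langle\nabla f(x),z-x\rangle+\mu\bigl(\phi(z)-\phi(x)-\langle\nabla\phi(x),z-x\rangle\bigr)$.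 Put $\tilde f=f-\mu\phi$, $\kappa=L/\mu$, $\beta=\frac12\sqrt{\mu/(L(1+L_\phi/\lambda))}$, and let the weights be $\alpha_t>0$ with $\alpha_1=\frac1{2L(1+L_\phi/\lambda)}$ and $\alpha_t/A_t=\beta$ for $t\ge2$, where $A_t=\sum_{s=1}^t\alpha_s$. **Gauge Frank–Wolfe, iterative form.** Start from an arbitrary $w_0=v_0\in K$; for $t=1,\dots,T$ set $z_t=(1-\beta)w_{t-1}+\beta v_{t-1}$, $\zeta_t=\sum_{s=1}^t\alpha_s\nabla\tilde f(z_s)$, let $z_t^*$ be a minimizer of $\langle\zeta_t,\cdot\rangle$ over the boundary of $K$, $\rho_t=\max\bigl(0,\min\bigl(1,-\frac{\langle\zeta_t,z_t^*\rangle}{2(1/\mu+A_t)\mu/\lambda}\bigr)\bigr)$, $v_t=\rho_tz_t^*$, $w_t=(1-\beta)w_{t-1}+\beta v_t$. **Gauge Frank–Wolfe, game form.** Let $g(x,y)=\langle x,y\rangle-\tilde f^*(y)+\mu\phi(x)$, where $\tilde f^*(y)=\sup_{x\in K}(\langle x,y\rangle-\tilde f(x))$, let $Y=\{\nabla\tilde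 f(x):x\in K\}$, and let $x_0\in K$ be arbitrary. For $t=1,\dots,T$ the $y$-player plays optimistic follow-the-leader, $y_t\in\arg\min_{y\in Y}\bigl\{-\alpha_tg(x_{t-1},y)-\sum_{s=1}^{t-1}\alpha_sg(x_s,y)\bigr\}$, and then the $x$-player plays be-the-regularized-leader with regularizer $\phi$, $x_t\in\arg\min_{x\in K}\bigl\{\sum_{s=1}^t\alpha_sg(x,y_s)+\phi(x)\bigr\}$. The output is $\bar x_T=\frac1{A_T}\sum_{s=1}^T\alpha_sx_s$. **Theorem.** There is a constant $C>0$, depending only on $\lambda,L_\phi,L,\mu$, such that in every such situation (every $d$, $K$, $f$) $f$ attains its minimum over $K$, and 1. for every $T\ge0$ and every run of the iterative form, $$f(w_T)-\min_Kf\le C\,\bigl(1+f(w_0)-\min_Kf\bigr)\exp\Bigl(-\frac{T}{2\sqrt{1+L_\phi/\lambda}\,\sqrt\kappa}\Bigr);$$ 2. for every $T\ge1$ and every run of the game form, $$f(\bar x_T)-\min_Kf\le C\exp\Bigl(-\frac{T}{2\sqrt{1+L_\phi/\lambda}\,\sqrt\kappa}\Bigr).$$ -/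

import Mathlib

noncomputable section

namespace GaugeFW

/-- `ℝ^d` with its standard inner product. -/
abbrev Vec (d : ℕ) := EuclideanSpace ℝ (Fin d)

variable {d : ℕ}

/-- The dual of the gauge of `K`: `y ↦ max {⟨y, u⟩ : u ∈ K}`. As `K` is the unit ball of its gauge,
this is the dual norm whenever the gauge is a norm (that is, whenever `K = -K`). -/
def dualGauge (K : Set (Vec d)) (y : Vec d) : ℝ :=
  sSup ((fun u : Vec d => inner ℝ y u) '' K)

/-- `K` is convex and `m`-strongly convex with respect to `N` (a norm, or a gauge): for `x, z ∈ K`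
and `θ ∈ [0,1]` the `N`-ball with centre `θ x + (1 - θ) z` and radius
`θ (1 - θ) (m / 2) N (x - z) ^ 2` is contained in `K`. -/
def IsStronglyConvexSet (N : Vec d → ℝ) (m : ℝ) (K : Set (Vec d)) : Prop :=
  Convex ℝ K ∧
    ∀ x ∈ K, ∀ z ∈ K, ∀ θ : ℝ, 0 ≤ θ → θ ≤ 1 →
      {y : Vec d | N (y - (θ • x + (1 - θ) • z)) ≤ θ * (1 - θ) * (m / 2) * N (x - z) ^ 2} ⊆ K

/-- `lam`-Gauge set: a closed bounded set with the origin in its interior that is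
`lam / 2`-strongly convex with respect to its own gauge. -/
structure IsGaugeSet (lam : ℝ) (K : Set (Vec d)) : Prop where
  isClosed : IsClosed K
  isBounded : Bornology.IsBounded K
  zero_mem_interior : (0 : Vec d) ∈ interior K
  stronglyConvex : IsStronglyConvexSet (gauge K) (lam / 2) K

/-- `f` is differentiable on `ℝ^d` and `L`-smooth with respect to the gauge of `K`:
`‖∇f(x) - ∇f(z)‖_* ≤ L ‖x - z‖` with the gauge of `K` on the right and its dual on the left. -/
def IsSmooth (K : Set (Vec d)) (f : Vec d → ℝ) (L : ℝ) : Prop :=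
  Differentiable ℝ f ∧
    ∀ x z : Vec d, dualGauge K (gradient f x - gradient f z) ≤ L * gauge K (x - z)

/-- The Bregman divergence `D_z(x) = φ(x) - ⟨∇φ(z), x - z⟩ - φ(z)`. -/
def bregman (φ : Vec d → ℝ) (z x : Vec d) : ℝ :=
  φ x - inner ℝ (gradient φ z) (x - z) - φ z

/-- `f` is `mu`-strongly convex on `K` relative to the distance generating function `φ`. -/
def IsRelStronglyConvexOn (K : Set (Vec d)) (φ f : Vec d → ℝ) (mu : ℝ) : Prop :=
  ∀ z ∈ K, ∀ x ∈ K,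
    f z ≥ f x + inner ℝ (gradient f x) (z - x) + mu * bregman φ x z

/-- `φ = (1 / lam) γ_K ^ 2`. -/
def gaugeReg (K : Set (Vec d)) (lam : ℝ) (x : Vec d) : ℝ := 1 / lam * gauge K x ^ 2

/-- `f̃ = f - (mu / lam) γ_K ^ 2`. -/
def fTilde (K : Set (Vec d)) (lam mu : ℝ) (f : Vec d → ℝ) (x : Vec d) : ℝ :=
  f x - mu / lam * gauge K x ^ 2

/-- `β = (1 / 2) √(mu / (L (1 + Lphi / lam)))`. -/
def stepRatio (lam Lphi L mu : ℝ) : ℝ := 1 / 2 * √(mu / (L * (1 + Lphi / lam)))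

/-- The cumulative weight `A_t = α_1 + ⋯ + α_t`. -/
def cumWeight (α : ℕ → ℝ) (t : ℕ) : ℝ := ∑ s ∈ Finset.Icc 1 t, α s

/-- The weights: `α_1 = 1 / (2 L (1 + Lphi / lam))` and `α_t / A_t = β` for `t = 2, …, T`. -/
def IsWeightSeq (lam Lphi L mu : ℝ) (T : ℕ) (α : ℕ → ℝ) : Prop :=
  α 1 = 1 / (2 * L * (1 + Lphi / lam)) ∧
    (∀ t, 1 ≤ t → t ≤ T → 0 < α t) ∧
    ∀ t, 2 ≤ t → t ≤ T → α t / cumWeight α t = stepRatio lam Lphi L mu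

/-! ### Gauge Frank-Wolfe, iterative description -/

/-- `∑_{s=1}^t α_s ∇f̃(z_s)`. -/
def gradSum (K : Set (Vec d)) (lam mu : ℝ) (f : Vec d → ℝ) (α : ℕ → ℝ) (z : ℕ → Vec d) (t : ℕ) :
    Vec d :=
  ∑ s ∈ Finset.Icc 1 t, α s • gradient (fTilde K lam mu f) (z s)

/-- `T` iterations of Gauge Frank-Wolfe: `zs t` is the answer of the linear optimization oracle
over the boundary of `K`, and `v t` is its multiple by the clipped step `ρ_t ∈ [0,1]`. -/
structure IsGaugeFWRun (K : Set (Vec d)) (f : Vec d → ℝ) (lam Lphi L mu : ℝ) (T : ℕ)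
    (α : ℕ → ℝ) (z zs v w : ℕ → Vec d) : Prop where
  weights : IsWeightSeq lam Lphi L mu T α
  init_mem : w 0 ∈ K
  init_eq : v 0 = w 0
  query : ∀ t, 1 ≤ t → t ≤ T →
    z t = (1 - stepRatio lam Lphi L mu) • w (t - 1) + stepRatio lam Lphi L mu • v (t - 1)
  oracle_mem : ∀ t, 1 ≤ t → t ≤ T → zs t ∈ frontier K
  oracle_min : ∀ t, 1 ≤ t → t ≤ T →
    IsMinOn (fun u : Vec d => inner ℝ (gradSum K lam mu f α z t) u) (frontier K) (zs t)
  step : ∀ t, 1 ≤ t → t ≤ T →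
    v t = max 0 (min 1 (-(inner ℝ (gradSum K lam mu f α z t) (zs t) /
      (2 * (1 / mu + cumWeight α t) * (mu / lam))))) • zs t
  average : ∀ t, 1 ≤ t → t ≤ T →
    w t = (1 - stepRatio lam Lphi L mu) • w (t - 1) + stepRatio lam Lphi L mu • v t

/-! ### Gauge Frank-Wolfe, as no-regret dynamics in the Fenchel game -/

/-- The Fenchel conjugate of the function that is `h` on `K` and `+∞` off `K`. -/
def conjOn (K : Set (Vec d)) (h : Vec d → ℝ) (y : Vec d) : ℝ :=
  sSup ((fun x : Vec d => inner ℝ x y - h x) '' K)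

/-- The gradient space `{∇h(x) : x ∈ K}`, the decision set of the `y`-player. -/
def gradSpace (K : Set (Vec d)) (h : Vec d → ℝ) : Set (Vec d) := gradient h '' K

/-- The payoff `g(x, y) = ⟨x, y⟩ - f̃^*(y) + (mu / lam) γ_K(x) ^ 2`. -/
def payoff (K : Set (Vec d)) (lam mu : ℝ) (f : Vec d → ℝ) (x y : Vec d) : ℝ :=
  inner ℝ x y - conjOn K (fTilde K lam mu f) y + mu / lam * gauge K x ^ 2

/-- In round `t` Optimistic Follow The Leader with losses `ℓ`, guess `m` for the current loss,
decision set `Z` and weights `α` may play `p`. -/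
def IsOFTL (Z : Set (Vec d)) (α : ℕ → ℝ) (ℓ : ℕ → Vec d → ℝ) (m : Vec d → ℝ) (t : ℕ)
    (p : Vec d) : Prop :=
  p ∈ Z ∧ IsMinOn (fun y => α t * m y + ∑ s ∈ Finset.Icc 1 (t - 1), α s * ℓ s y) Z p

/-- In round `t` Be The Regularized Leader with losses `h`, regularizer `R`, parameter `η`,
decision set `Z` and weights `α` may play `p`. -/
def IsBTRL (Z : Set (Vec d)) (α : ℕ → ℝ) (h : ℕ → Vec d → ℝ) (R : Vec d → ℝ) (η : ℝ) (t : ℕ)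
    (p : Vec d) : Prop :=
  p ∈ Z ∧ IsMinOn (fun x => (∑ s ∈ Finset.Icc 1 t, α s * h s x) + 1 / η * R x) Z p

/-- `T` rounds of the Fenchel game: the `y`-player moves first and plays OFTL, guessing the
previous loss (with `x 0` an arbitrary point of `K`); the `x`-player sees `y t` and plays
`BTRL[(1 / lam) γ_K ^ 2, 1]`. -/
structure IsFenchelGameRun (K : Set (Vec d)) (f : Vec d → ℝ) (lam Lphi L mu : ℝ) (T : ℕ)
    (α : ℕ → ℝ) (x y : ℕ → Vec d) : Prop where
  weights : IsWeightSeq lam Lphi L mu T α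
  init_mem : x 0 ∈ K
  yPlayer : ∀ t, 1 ≤ t → t ≤ T →
    IsOFTL (gradSpace K (fTilde K lam mu f)) α (fun s p => -payoff K lam mu f (x s) p)
      (fun p => -payoff K lam mu f (x (t - 1)) p) t (y t)
  xPlayer : ∀ t, 1 ≤ t → t ≤ T →
    IsBTRL K α (fun s p => payoff K lam mu f p (y s)) (gaugeReg K lam) 1 t (x t)

/-- The weighted average `x̄_T = (1 / A_T) ∑_{s=1}^T α_s x_s`. -/
def weightedAvg (α : ℕ → ℝ) (x : ℕ → Vec d) (T : ℕ) : Vec d :=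
  (cumWeight α T)⁻¹ • ∑ s ∈ Finset.Icc 1 T, α s • x s

end GaugeFW

end

namespace GaugeFW

variable {d : ℕ}

/-! ### Calculus with gradients -/

/-! Both algorithms are the same accelerated scheme, analysed with Nesterov's estimate functions
`E_t(p) = ∑_{s ≤ t} α_s (f̃(z_s) + ⟨∇f̃(z_s), p - z_s⟩ + μ φ(p)) + φ(p)`. In either form `v_t`
minimizes `E_t` over `K`. In the iterative form `E_t` is, up to a constant, linear plus a multiple
of `γ_K ^ 2`, so it is minimized by choosing the best boundary direction and then a clipped step
along it (`IsGaugeSet.isMinOn_clip`). In the game form the `y`-player is forced to answer with the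
gradient of `f̃` at the optimistic average (`IsGaugeSet.eq_gradient_of_isMinOn`), after which the
`x`-player's objective is `E_t` up to a constant.

The invariant is `A_t f(w_t) ≤ min_K E_t + α_1 B`, where `B` measures the defect of the first round.
Convexity of `f̃` gives `E_T(p) ≤ A_T f(p) + 1/λ` on `K`, so the gap is at most `(α_1 B + 1/λ) /
A_T`, and `A_T` grows geometrically. The induction step sets the error `A_t (L/2) β² γ(v_t -
v_{t-1})²` of the smoothness bound (`IsGaugeSet.objective_step_le`) against the quadratic growth of
`E_{t-1}` around its minimizer (`IsGaugeSet.growth_of_isMinOn`).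

That growth is the geometric input: strong convexity of the set `K` makes `γ_K ^ 2` strongly convex
with respect to the gauge, with constant independent of the dimension
(`IsGaugeSet.bregman_gauge_sq_ge`). As `K` need not be symmetric, `γ(-x)` must first be controlled
by `γ(x)`. -/

theorem hasDerivAt_line {h : Vec d → ℝ} {x v : Vec d} {t : ℝ}
    (hd : DifferentiableAt ℝ h (x + t • v)) :
    HasDerivAt (fun s : ℝ => h (x + s • v)) (inner ℝ (gradient h (x + t • v)) v) t := by
  have h1 : HasDerivAt (fun s : ℝ => x + s • v) v t := by
    simpa using ((hasDerivAt_id t).smul_const v).const_add x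
  exact hd.hasGradientAt.hasFDerivAt.comp_hasDerivAt t h1

/-- First-order optimality condition on a convex set. -/
theorem inner_nonneg_of_isMinOn {S : Set (Vec d)} (hS : Convex ℝ S) {h : Vec d → ℝ}
    {g a b : Vec d} (hg : HasGradientAt h g a) (hmin : IsMinOn h S a) (ha : a ∈ S) (hb : b ∈ S) :
    0 ≤ inner ℝ g (b - a) := by
  have h1 := hmin.localize.hasFDerivWithinAt_nonneg hg.hasFDerivAt.hasFDerivWithinAt
    (sub_mem_posTangentConeAt_of_segment_subset (hS.segment_subset ha hb))
  simpa using h1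

theorem eq_zero_of_isMinOn_of_mem_interior {S : Set (Vec d)} {h : Vec d → ℝ}
    {g a : Vec d} (hg : HasGradientAt h g a) (hmin : IsMinOn h S a) (ha : a ∈ interior S) :
    g = 0 := by
  have h1 : IsLocalMin h a := hmin.isLocalMin (mem_interior_iff_mem_nhds.1 ha)
  have h2 := h1.hasFDerivAt_eq_zero hg.hasFDerivAt
  simpa using h2

theorem deriv_nonneg_of_nonneg_on_unitInterval {k : ℝ → ℝ} {k' : ℝ} (hk : HasDerivAt k k' 0)
    (h0 : k 0 = 0) (hpos : ∀ t, 0 ≤ t → t ≤ 1 → 0 ≤ k t) : 0 ≤ k' := by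
  have hmin : IsMinOn k (Set.Icc 0 1) 0 := fun t ht => by
    simpa [h0] using hpos t ht.1 ht.2
  have h1 := hmin.localize.hasFDerivWithinAt_nonneg hk.hasFDerivAt.hasFDerivWithinAt
    (sub_mem_posTangentConeAt_of_segment_subset (x := (0 : ℝ)) (y := 1)
      ((convex_Icc (0 : ℝ) 1).segment_subset (by simp) (by simp)))
  simpa using h1

/-! ### The gauge of a gauge set -/

namespace IsGaugeSet

variable {lam : ℝ} {K : Set (Vec d)}

theorem convex (hK : IsGaugeSet lam K) : Convex ℝ K := hK.stronglyConvex.1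

theorem mem_nhds (hK : IsGaugeSet lam K) : K ∈ nhds (0 : Vec d) :=
  mem_interior_iff_mem_nhds.1 hK.zero_mem_interior

theorem zero_mem (hK : IsGaugeSet lam K) : (0 : Vec d) ∈ K :=
  interior_subset hK.zero_mem_interior

theorem isCompact (hK : IsGaugeSet lam K) : IsCompact K :=
  Metric.isCompact_of_isClosed_isBounded hK.isClosed hK.isBounded

theorem gauge_le_one_iff (hK : IsGaugeSet lam K) {x : Vec d} : gauge K x ≤ 1 ↔ x ∈ K := by
  rw [gauge_le_one_iff_mem_closure hK.convex hK.mem_nhds, hK.isClosed.closure_eq]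

theorem gauge_add_le (hK : IsGaugeSet lam K) (x y : Vec d) :
    gauge K (x + y) ≤ gauge K x + gauge K y :=
  _root_.gauge_add_le hK.convex (absorbent_nhds_zero hK.mem_nhds) x y

theorem gauge_pos (hK : IsGaugeSet lam K) {x : Vec d} : 0 < gauge K x ↔ x ≠ 0 :=
  _root_.gauge_pos (absorbent_nhds_zero hK.mem_nhds)
    ((NormedSpace.isVonNBounded_iff ℝ).2 hK.isBounded)

end IsGaugeSet

theorem gauge_smul_nonneg (K : Set (Vec d)) {a : ℝ} (ha : 0 ≤ a) (x : Vec d) :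
    gauge K (a • x) = a * gauge K x := by
  simpa using gauge_smul_of_nonneg (s := K) ha x

/-- Normalization onto the boundary; for `x = 0` the convention `0⁻¹ = 0` returns the origin, so no
case split is needed. -/
theorem IsGaugeSet.smul_inv_gauge_mem {lam : ℝ} {K : Set (Vec d)} (hK : IsGaugeSet lam K)
    (x : Vec d) : (gauge K x)⁻¹ • x ∈ K := by
  rw [← hK.gauge_le_one_iff, gauge_smul_nonneg K (inv_nonneg.2 (gauge_nonneg x))]
  exact inv_mul_le_one

theorem IsGaugeSet.gauge_smul_inv_gauge_smul {lam : ℝ} {K : Set (Vec d)} (hK : IsGaugeSet lam K)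
    (x : Vec d) : gauge K x • (gauge K x)⁻¹ • x = x := by
  by_cases hx : x = 0
  · simp [hx]
  · exact smul_inv_smul₀ (hK.gauge_pos.2 hx).ne' x

theorem IsGaugeSet.inner_le_dualGauge_mul {lam : ℝ} {K : Set (Vec d)} (hK : IsGaugeSet lam K)
    (y u : Vec d) : inner ℝ y u ≤ dualGauge K y * gauge K u := by
  have hb : BddAbove ((fun u : Vec d => inner ℝ y u) '' K) :=
    hK.isCompact.bddAbove_image (by fun_prop)
  have h1 : inner ℝ y ((gauge K u)⁻¹ • u) ≤ dualGauge K y :=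
    le_csSup hb ⟨_, hK.smul_inv_gauge_mem u, rfl⟩
  calc inner ℝ y u = inner ℝ y ((gauge K u)⁻¹ • u) * gauge K u := by
        conv_lhs => rw [← hK.gauge_smul_inv_gauge_smul u]
        rw [real_inner_smul_right, mul_comm]
    _ ≤ _ := mul_le_mul_of_nonneg_right h1 (gauge_nonneg u)

/-- The descent lemma for functions that are smooth with respect to the gauge. -/
theorem IsSmooth.le_quadratic {lam : ℝ} {K : Set (Vec d)} (hK : IsGaugeSet lam K)
    {h : Vec d → ℝ} {M : ℝ} (hh : IsSmooth K h M) (x z : Vec d) :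
    h x ≤ h z + inner ℝ (gradient h z) (x - z) + M / 2 * gauge K (x - z) ^ 2 := by
  set v := x - z with hv
  set k : ℝ → ℝ := fun t => h (z + t • v) - t * inner ℝ (gradient h z) v
    - M / 2 * gauge K v ^ 2 * t ^ 2 with hk
  have hder : ∀ t : ℝ, HasDerivAt k (inner ℝ (gradient h (z + t • v)) v
      - inner ℝ (gradient h z) v - M * gauge K v ^ 2 * t) t := fun t => by
    have h1 := hasDerivAt_line (hh.1 (z + t • v))
    have h2 := (hasDerivAt_id t).mul_const (inner ℝ (gradient h z) v)
    have h3 := ((hasDerivAt_id t).pow 2).const_mul (M / 2 * gauge K v ^ 2)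
    refine ((h1.sub h2).sub h3).congr_deriv ?_
    simp; ring
  have hanti : AntitoneOn k (Set.Icc 0 1) := by
    refine antitoneOn_of_deriv_nonpos (convex_Icc 0 1)
      (fun t _ => (hder t).continuousAt.continuousWithinAt)
      (fun t _ => (hder t).differentiableAt.differentiableWithinAt) fun t ht => ?_
    rw [interior_Icc] at ht
    rw [(hder t).deriv, ← inner_sub_left]
    have h1 := hK.inner_le_dualGauge_mul (gradient h (z + t • v) - gradient h z) v
    have h2 := mul_le_mul_of_nonneg_right (hh.2 (z + t • v) z) (gauge_nonneg (s := K) v)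
    rw [add_sub_cancel_left, gauge_smul_nonneg K ht.1.le] at h2
    linarith
  have h1 := hanti (Set.left_mem_Icc.2 zero_le_one) (Set.right_mem_Icc.2 zero_le_one) zero_le_one
  simp only [hk, one_smul, zero_smul, hv, add_sub_cancel, add_zero] at h1
  linarith

/-! ### Strong convexity of the squared gauge -/

section StrongConvexity

variable {lam : ℝ} {K : Set (Vec d)}

/-- The radial direction of `p` makes the triangle inequality an equality. Moving along it reaches
the outermost point of a gauge ball around `p`, which turns the ball inclusion defining strong
convexity into a scalar inequality. -/
theorem IsGaugeSet.exists_gauge_add_smul (hK : IsGaugeSet lam K) (p : Vec d) {v : Vec d}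
    (hv : v ≠ 0) : ∃ u, gauge K u = 1 ∧ ∀ r, 0 ≤ r → gauge K (p + r • u) = gauge K p + r := by
  have key : ∀ q : Vec d, q ≠ 0 → gauge K ((gauge K q)⁻¹ • q) = 1 := fun q hq => by
    rw [gauge_smul_nonneg K (inv_nonneg.2 (gauge_nonneg q)),
      inv_mul_cancel₀ (hK.gauge_pos.2 hq).ne']
  by_cases hp : p = 0
  · refine ⟨_, key v hv, fun r hr => ?_⟩
    rw [hp, zero_add, gauge_smul_nonneg K hr, key v hv, gauge_zero]; ring
  · refine ⟨_, key p hp, fun r hr => ?_⟩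
    have h0 := hK.gauge_pos.2 hp
    have h1 : p + r • (gauge K p)⁻¹ • p = (1 + r * (gauge K p)⁻¹) • p := by
      rw [add_smul, one_smul, mul_smul]
    rw [h1, gauge_smul_nonneg K (by positivity)]
    field_simp

theorem IsGaugeSet.gauge_combo_le_one (hlam : 0 < lam) (hK : IsGaugeSet lam K) {x z : Vec d}
    (hx : x ∈ K) (hz : z ∈ K) {θ : ℝ} (h0 : 0 ≤ θ) (h1 : θ ≤ 1) :
    gauge K (θ • x + (1 - θ) • z) + θ * (1 - θ) * (lam / 4) * gauge K (x - z) ^ 2 ≤ 1 := by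
  by_cases hxz : x = z
  · have : θ • x + (1 - θ) • z = z := by rw [hxz, ← add_smul]; simp
    rw [this, hxz]
    simpa using hK.gauge_le_one_iff.2 hz
  · obtain ⟨u, hu, hr⟩ :=
      hK.exists_gauge_add_smul (θ • x + (1 - θ) • z) (sub_ne_zero.2 hxz)
    have hpos : 0 ≤ θ * (1 - θ) * (lam / 4) * gauge K (x - z) ^ 2 := by
      have := sub_nonneg.2 h1
      positivity
    rw [← hr _ hpos, hK.gauge_le_one_iff]
    refine hK.stronglyConvex.2 x hx z hz θ h0 h1 ?_
    simp only [Set.mem_ofPred_eq, add_sub_cancel_left]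
    rw [gauge_smul_nonneg K hpos, hu]
    apply le_of_eq; ring

/-- Homogeneous version of the previous bound: divide both points by `γ(x)`, which puts them in `K`.
-/
theorem IsGaugeSet.gauge_combo_le (hlam : 0 < lam) (hK : IsGaugeSet lam K) {x y : Vec d}
    (hx : x ≠ 0) (hy : gauge K y ≤ gauge K x) {θ : ℝ} (h0 : 0 ≤ θ) (h1 : θ ≤ 1) :
    gauge K (x + θ • (y - x)) ≤
      gauge K x - θ * (1 - θ) * (lam / 4 * gauge K (y - x) ^ 2 / gauge K x) := by
  have ha := hK.gauge_pos.2 hx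
  have hi := inv_nonneg.2 ha.le
  have hxK := hK.smul_inv_gauge_mem x
  have hyK : (gauge K x)⁻¹ • y ∈ K := by
    rw [← hK.gauge_le_one_iff, gauge_smul_nonneg K hi]
    exact inv_mul_le_one_of_le₀ hy ha.le
  have h := hK.gauge_combo_le_one hlam hyK hxK h0 h1
  have e1 : θ • (gauge K x)⁻¹ • y + (1 - θ) • (gauge K x)⁻¹ • x
      = (gauge K x)⁻¹ • (x + θ • (y - x)) := by module
  rw [e1, ← smul_sub, gauge_smul_nonneg K hi, gauge_smul_nonneg K hi] at h
  have h2 := mul_le_mul_of_nonneg_left h ha.le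
  have e2 : gauge K x * ((gauge K x)⁻¹ * gauge K (x + θ • (y - x)) +
      θ * (1 - θ) * (lam / 4) * ((gauge K x)⁻¹ * gauge K (y - x)) ^ 2) =
      gauge K (x + θ • (y - x))
        + θ * (1 - θ) * (lam / 4 * gauge K (y - x) ^ 2 / gauge K x) := by
    field_simp
  linarith

variable (hd : Differentiable ℝ fun x : Vec d => gauge K x ^ 2)
include hd

/-- Euler's identity for a positively 2-homogeneous function. -/
theorem inner_gradient_gauge_sq_self (x : Vec d) :
    inner ℝ (gradient (fun x => gauge K x ^ 2) x) x = 2 * gauge K x ^ 2 := by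
  have h1 := hasDerivAt_line (x := x) (v := x) (t := 0) (hd _)
  have h2 : HasDerivAt (fun s : ℝ => (1 + s) ^ 2 * gauge K x ^ 2) (2 * gauge K x ^ 2) 0 := by
    have := (((hasDerivAt_id (0 : ℝ)).const_add 1).pow 2).mul_const (gauge K x ^ 2)
    exact this.congr_deriv (by simp)
  have h3 : (fun s : ℝ => gauge K (x + s • x) ^ 2)
      =ᶠ[nhds 0] fun s => (1 + s) ^ 2 * gauge K x ^ 2 := by
    filter_upwards [lt_mem_nhds (show (-1 : ℝ) < 0 by norm_num)] with s hs
    have : x + s • x = (1 + s) • x := by module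
    rw [this, gauge_smul_nonneg K (by linarith)]; ring
  have h4 := h1.unique (h2.congr_of_eventuallyEq h3)
  simpa using h4

theorem gradient_gauge_sq_zero : gradient (fun x => gauge K x ^ 2) (0 : Vec d) = 0 := by
  refine eq_zero_of_isMinOn_of_mem_interior (S := Set.univ) (hd 0).hasGradientAt
    (fun x _ => ?_) (by simp)
  simpa using sq_nonneg (gauge K x)

theorem IsGaugeSet.inner_gradient_gauge_sq_sub_le (hlam : 0 < lam) (hK : IsGaugeSet lam K)
    {x y : Vec d} (hx : x ≠ 0) (hy : gauge K y ≤ gauge K x) :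
    inner ℝ (gradient (fun x => gauge K x ^ 2) x) (y - x) ≤
      -(lam / 2 * gauge K (y - x) ^ 2) := by
  have ha := hK.gauge_pos.2 hx
  set c := lam / 4 * gauge K (y - x) ^ 2 / gauge K x with hc
  have h1 := hasDerivAt_line (x := x) (v := y - x) (t := 0) (hd _)
  have h2 : HasDerivAt (fun s : ℝ => (gauge K x - s * (1 - s) * c) ^ 2)
      (-(2 * gauge K x * c)) 0 := by
    have h3 := (((hasDerivAt_id (0 : ℝ)).mul ((hasDerivAt_id (0 : ℝ)).const_sub 1)).mul_const
      c).const_sub (gauge K x)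
    exact (h3.pow 2).congr_deriv (by simp)
  -- `(γ(x) - t(1-t)c)²` majorizes `γ²` on the segment and agrees with it at `t = 0`, so the
  -- derivatives there are ordered.
  have h3 := deriv_nonneg_of_nonneg_on_unitInterval (h2.sub h1) (by simp) fun t ht0 ht1 => by
    have := hK.gauge_combo_le hlam hx hy ht0 ht1
    exact sub_nonneg.2 (pow_le_pow_left₀ (gauge_nonneg _) this 2)
  have e : 2 * gauge K x * c = lam / 2 * gauge K (y - x) ^ 2 := by
    rw [hc]; field_simp; ring
  rw [e] at h3
  simp only [zero_smul, add_zero] at h3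
  linarith

/-- Measures the asymmetry of `K`: the first-order inequality is applied to `x` and the multiple of
`-x` on the same level set, with Euler's identity evaluating the left side. -/
theorem IsGaugeSet.gauge_neg_mul_le (hlam : 0 < lam) (hK : IsGaugeSet lam K) (x : Vec d) :
    lam * gauge K (-x) * (gauge K (-x) + gauge K x) ≤ 4 * gauge K x ^ 2 := by
  by_cases hx : x = 0
  · simp [hx]
  have ha := hK.gauge_pos.2 hx
  have hk := hK.gauge_pos.2 (neg_ne_zero.2 hx)
  set a := gauge K x
  set k := gauge K (-x)
  have hy : gauge K ((a / k) • -x) = a := by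
    rw [gauge_smul_nonneg K (by positivity)]; exact div_mul_cancel₀ _ hk.ne'
  have h := hK.inner_gradient_gauge_sq_sub_le hd hlam hx hy.le
  have e1 : (a / k) • -x - x = (a / k + 1) • -x := by module
  rw [e1, gauge_smul_nonneg K (by positivity), real_inner_smul_right, inner_neg_right,
    inner_gradient_gauge_sq_self hd] at h
  change (a / k + 1) * -(2 * a ^ 2) ≤ -(lam / 2 * ((a / k + 1) * k) ^ 2) at h
  have e2 : (a / k + 1) * k = a + k := by field_simp
  rw [e2] at h
  have h' := mul_le_mul_of_nonneg_right h hk.le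
  have e3 : (a / k + 1) * -(2 * a ^ 2) * k = -(2 * a ^ 2) * (a + k) := by rw [← e2]; ring
  rw [e3] at h'
  have h4 : 0 ≤ (a + k) * (4 * a ^ 2 - lam * k * (k + a)) := by nlinarith
  have := nonneg_of_mul_nonneg_right h4 (by positivity)
  linarith

theorem IsGaugeSet.gauge_neg_sq_le (hlam : 0 < lam) (hK : IsGaugeSet lam K) (x : Vec d) :
    lam * gauge K (-x) ^ 2 ≤ 4 * gauge K x ^ 2 := by
  have h := hK.gauge_neg_mul_le hd hlam x
  have : 0 ≤ lam * gauge K (-x) * gauge K x :=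
    mul_nonneg (mul_nonneg hlam.le (gauge_nonneg _)) (gauge_nonneg _)
  nlinarith

/-- Of `v` and `-v`, take as `x` the one with the smaller gauge in the asymmetry bound. -/
theorem IsGaugeSet.le_two (hlam : 0 < lam) (hK : IsGaugeSet lam K) {v : Vec d} (hv : v ≠ 0) :
    lam ≤ 2 := by
  have key : ∀ x : Vec d, x ≠ 0 → gauge K x ≤ gauge K (-x) → lam ≤ 2 := fun x hx hle => by
    have h := hK.gauge_neg_mul_le hd hlam x
    have ha := hK.gauge_pos.2 hx
    have hk : 0 ≤ gauge K (-x) := gauge_nonneg _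
    have h1 : lam * gauge K x * (gauge K x + gauge K x) ≤
        lam * gauge K (-x) * (gauge K (-x) + gauge K x) := by gcongr
    have h2 : 0 ≤ gauge K x ^ 2 * (2 - lam) := by nlinarith
    linarith [nonneg_of_mul_nonneg_right h2 (by positivity)]
  rcases le_total (gauge K v) (gauge K (-v)) with h | h
  · exact key v hv h
  · exact key (-v) (neg_ne_zero.2 hv) (by simpa using h)

/-- The squared gauge of a gauge set is strongly convex with respect to the gauge. -/
theorem IsGaugeSet.bregman_gauge_sq_ge (hlam : 0 < lam) (hK : IsGaugeSet lam K) (x w : Vec d) :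
    lam / 6 * gauge K (w - x) ^ 2 ≤ bregman (fun x => gauge K x ^ 2) x w := by
  unfold bregman
  by_cases hx : x = 0
  · subst hx
    rw [gradient_gauge_sq_zero hd]
    by_cases hw : w = 0
    · simp [hw]
    have := hK.le_two hd hlam hw
    have h2 := sq_nonneg (gauge K w)
    simp only [sub_zero, inner_zero_left, gauge_zero]
    nlinarith
  have ha := hK.gauge_pos.2 hx
  have hself := inner_gradient_gauge_sq_self hd x
  have hneg := hK.gauge_neg_sq_le hd hlam x
  have hl2 := hK.le_two hd hlam hx
  rw [inner_sub_right, hself]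
  by_cases hw : w = 0
  · subst hw
    simp only [zero_sub, inner_zero_right, gauge_zero]
    nlinarith [sq_nonneg (gauge K x)]
  have hb := hK.gauge_pos.2 hw
  set a := gauge K x with ha'
  set b := gauge K w with hb'
  -- The first-order inequality compares points with `γ(y) ≤ γ(x)`, so `w` is rescaled to the level
  -- of `x`.
  set y := (a / b) • w with hy'
  have hy : gauge K y = a := by
    rw [hy', gauge_smul_nonneg K (by positivity)]; exact div_mul_cancel₀ _ hb.ne'
  have h := hK.inner_gradient_gauge_sq_sub_le hd hlam hx hy.le
  set R := gauge K (y - x) with hR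
  have hR0 : 0 ≤ R := gauge_nonneg _
  have hin : inner ℝ (gradient (fun x => gauge K x ^ 2) x) w ≤
      b / a * (2 * a ^ 2 - lam / 2 * R ^ 2) := by
    have e : w = (b / a) • y := by
      rw [hy', smul_smul]; field_simp; simp
    rw [e, real_inner_smul_right]
    rw [inner_sub_right, hself] at h
    exact mul_le_mul_of_nonneg_left (by linarith) (by positivity)
  have e1 : b / a * (2 * a ^ 2 - lam / 2 * R ^ 2) = 2 * a * b - lam / 2 * (b / a) * R ^ 2 := by
    field_simp
  rw [e1] at hin
  suffices hs : lam / 6 * gauge K (w - x) ^ 2 ≤ (a - b) ^ 2 + lam / 2 * (b / a) * R ^ 2 by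
    nlinarith
  -- This split fixes the constant `1/6`: the `R²` terms then match exactly, and for `b ≤ a` so do
  -- the radial terms, through `λ γ(-x)² ≤ 4 a²`.
  have hsq : ∀ p q : ℝ, (p + q) ^ 2 ≤ 3 * p ^ 2 + 3 / 2 * q ^ 2 := fun p q => by
    nlinarith [sq_nonneg (2 * p - q)]
  rcases le_total a b with hab | hab
  · have e : w - x = (y - x) + (1 - a / b) • w := by rw [hy']; module
    have h1b : 0 ≤ 1 - a / b := sub_nonneg.2 ((div_le_one hb).2 hab)
    have hle : gauge K (w - x) ≤ R + (b - a) := by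
      rw [e]
      refine (hK.gauge_add_le _ _).trans (add_le_add le_rfl ?_)
      rw [gauge_smul_nonneg K h1b, ← hb']
      apply le_of_eq; field_simp
    have h2 : gauge K (w - x) ^ 2 ≤ 3 * R ^ 2 + 3 / 2 * (b - a) ^ 2 :=
      (pow_le_pow_left₀ (gauge_nonneg _) hle 2).trans (hsq _ _)
    have h3 : 1 ≤ b / a := (one_le_div ha).2 hab
    have h4 : lam / 2 * 1 * R ^ 2 ≤ lam / 2 * (b / a) * R ^ 2 := by gcongr
    nlinarith [sq_nonneg (b - a)]
  · have e : w - x = (b / a) • (y - x) + (1 - b / a) • (-x) := by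
      rw [hy', smul_sub, smul_smul]
      have : b / a * (a / b) = 1 := by field_simp
      rw [this]; module
    have h1b : 0 ≤ 1 - b / a := sub_nonneg.2 ((div_le_one ha).2 hab)
    have hle : gauge K (w - x) ≤ b / a * R + (1 - b / a) * gauge K (-x) := by
      conv_lhs => rw [e]
      refine (hK.gauge_add_le _ _).trans (le_of_eq ?_)
      rw [gauge_smul_nonneg K (by positivity), gauge_smul_nonneg K h1b]
    have h2 := (pow_le_pow_left₀ (gauge_nonneg _) hle 2).trans (hsq _ _)
    have h3 : (b / a) ^ 2 ≤ b / a := by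
      have : b / a ≤ 1 := (div_le_one ha).2 hab
      have : 0 < b / a := by positivity
      nlinarith
    have h4 : (1 - b / a) ^ 2 * (lam * gauge K (-x) ^ 2) ≤ (1 - b / a) ^ 2 * (4 * a ^ 2) := by
      gcongr
    have e4 : (1 - b / a) ^ 2 * (4 * a ^ 2) = 4 * (a - b) ^ 2 := by field_simp
    have h5 : lam / 2 * ((b / a) ^ 2 * R ^ 2) ≤ lam / 2 * ((b / a) * R ^ 2) := by gcongr
    have h6 := mul_le_mul_of_nonneg_left h2 (show 0 ≤ lam / 6 by positivity)
    nlinarith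

end StrongConvexity

/-! ### The shifted objective -/

section Objective

variable {lam Lphi L mu : ℝ} {K : Set (Vec d)} {f : Vec d → ℝ}

theorem hasGradientAt_gaugeReg (hd : Differentiable ℝ fun x : Vec d => gauge K x ^ 2)
    (x : Vec d) : HasGradientAt (gaugeReg K lam)
      ((1 / lam) • gradient (fun x => gauge K x ^ 2) x) x := by
  rw [hasGradientAt_iff_hasFDerivAt, map_smul]
  exact (hd x).hasGradientAt.hasFDerivAt.const_mul (1 / lam)

theorem hasGradientAt_fTilde (hd : Differentiable ℝ fun x : Vec d => gauge K x ^ 2)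
    (hf : Differentiable ℝ f) (x : Vec d) : HasGradientAt (fTilde K lam mu f)
      (gradient f x - (mu / lam) • gradient (fun x => gauge K x ^ 2) x) x := by
  rw [hasGradientAt_iff_hasFDerivAt, map_sub, map_smul]
  exact (hf x).hasGradientAt.hasFDerivAt.sub
    ((hd x).hasGradientAt.hasFDerivAt.const_mul (mu / lam))

theorem bregman_gaugeReg (hd : Differentiable ℝ fun x : Vec d => gauge K x ^ 2) (x z : Vec d) :
    bregman (gaugeReg K lam) x z = 1 / lam * bregman (fun x => gauge K x ^ 2) x z := by
  simp only [bregman, (hasGradientAt_gaugeReg hd x).gradient, real_inner_smul_left, gaugeReg]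
  ring

theorem fTilde_add (x : Vec d) : fTilde K lam mu f x + mu * gaugeReg K lam x = f x := by
  unfold fTilde gaugeReg; ring

theorem gaugeReg_nonneg (hlam : 0 < lam) (x : Vec d) : 0 ≤ gaugeReg K lam x := by
  unfold gaugeReg; positivity

theorem IsGaugeSet.gaugeReg_le (hlam : 0 < lam) (hK : IsGaugeSet lam K) {x : Vec d}
    (hx : x ∈ K) : gaugeReg K lam x ≤ 1 / lam := by
  have h1 : gauge K x ^ 2 ≤ 1 :=
    pow_le_one₀ (gauge_nonneg _) (hK.gauge_le_one_iff.2 hx)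
  unfold gaugeReg
  exact mul_le_of_le_one_right (by positivity) h1

theorem IsGaugeSet.gaugeReg_combo_le (hlam : 0 < lam) (hK : IsGaugeSet lam K) (x y : Vec d)
    {b : ℝ} (h0 : 0 ≤ b) (h1 : b ≤ 1) :
    gaugeReg K lam ((1 - b) • x + b • y) ≤
      (1 - b) * gaugeReg K lam x + b * gaugeReg K lam y := by
  have h1' := sub_nonneg.2 h1
  have h2 := hK.gauge_add_le ((1 - b) • x) (b • y)
  rw [gauge_smul_nonneg K h1', gauge_smul_nonneg K h0] at h2
  have h3 := pow_le_pow_left₀ (gauge_nonneg _) h2 2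
  have h4 : ((1 - b) * gauge K x + b * gauge K y) ^ 2 ≤
      (1 - b) * gauge K x ^ 2 + b * gauge K y ^ 2 := by
    nlinarith [mul_nonneg (mul_nonneg h0 h1') (sq_nonneg (gauge K x - gauge K y))]
  have h5 := mul_le_mul_of_nonneg_left (h3.trans h4) (show 0 ≤ 1 / lam by positivity)
  unfold gaugeReg
  linarith

theorem IsRelStronglyConvexOn.fTilde_le (hd : Differentiable ℝ fun x : Vec d => gauge K x ^ 2)
    (hf : Differentiable ℝ f) (hs : IsRelStronglyConvexOn K (gaugeReg K lam) f mu)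
    {x z : Vec d} (hx : x ∈ K) (hz : z ∈ K) :
    fTilde K lam mu f x + inner ℝ (gradient (fTilde K lam mu f) x) (z - x) ≤
      fTilde K lam mu f z := by
  have h := hs z hz x hx
  rw [bregman_gaugeReg hd] at h
  rw [(hasGradientAt_fTilde hd hf x).gradient, inner_sub_left, real_inner_smul_left]
  simp only [bregman, fTilde] at h ⊢
  have e : ∀ a : ℝ, mu * (1 / lam * a) = mu / lam * a := fun a => by ring
  rw [e] at h
  linarith

/-- Subtracting `μ φ` only lowers the upper model, because the Bregman divergence of `φ` is
nonnegative; hence `f̃` inherits the constant `L`. -/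
theorem IsGaugeSet.fTilde_le_quadratic (hlam : 0 < lam) (hmu : 0 < mu) (hK : IsGaugeSet lam K)
    (hd : Differentiable ℝ fun x : Vec d => gauge K x ^ 2)
    (hf : IsSmooth K f L) (x z : Vec d) :
    fTilde K lam mu f x ≤ fTilde K lam mu f z +
      inner ℝ (gradient (fTilde K lam mu f) z) (x - z) + L / 2 * gauge K (x - z) ^ 2 := by
  have h := hf.le_quadratic hK x z
  have h2 : 0 ≤ mu / lam * bregman (fun x => gauge K x ^ 2) z x :=
    mul_nonneg (by positivity)
      (le_trans (by positivity) (hK.bregman_gauge_sq_ge hd hlam z x))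
  rw [(hasGradientAt_fTilde hd hf.1 z).gradient, inner_sub_left, real_inner_smul_left]
  simp only [bregman, fTilde] at h2 ⊢
  linarith

/-- One step of the accelerated scheme. -/
theorem IsGaugeSet.objective_step_le (hlam : 0 < lam) (hmu : 0 < mu) (hK : IsGaugeSet lam K)
    (hd : Differentiable ℝ fun x : Vec d => gauge K x ^ 2) (hf : IsSmooth K f L)
    (hs : IsRelStronglyConvexOn K (gaugeReg K lam) f mu) {b : ℝ} (h0 : 0 ≤ b) (h1 : b ≤ 1)
    {w v v' z w' : Vec d} (hw : w ∈ K) (hv : v ∈ K)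
    (hz : z = (1 - b) • w + b • v) (hw' : w' = (1 - b) • w + b • v') :
    f w' ≤ (1 - b) * f w + b * (fTilde K lam mu f z +
        inner ℝ (gradient (fTilde K lam mu f) z) (v' - z) + mu * gaugeReg K lam v') +
      L / 2 * b ^ 2 * gauge K (v' - v) ^ 2 := by
  have hzK : z ∈ K := hz ▸ hK.convex hw hv (sub_nonneg.2 h1) h0 (by ring)
  have hup := hK.fTilde_le_quadratic hlam hmu hd hf w' z
  have hlo := hs.fTilde_le hd hf.1 hzK hw
  have hreg := hK.gaugeReg_combo_le hlam w v' h0 h1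
  rw [← hw'] at hreg
  -- The displacement is used twice: this form makes the quadratic error of order `b²`, the next one
  -- splits the linear term between `w` and `v'`.
  have e1 : w' - z = b • (v' - v) := by rw [hw', hz]; module
  have e2 : w' - z = (1 - b) • (w - z) + b • (v' - z) := by rw [hw']; module
  have e3 : gauge K (w' - z) ^ 2 = b ^ 2 * gauge K (v' - v) ^ 2 := by
    rw [e1, gauge_smul_nonneg K h0]; ring
  rw [e3, e2, inner_add_right, real_inner_smul_right, real_inner_smul_right] at hup
  have h2 := mul_le_mul_of_nonneg_left hlo (sub_nonneg.2 h1)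
  have h3 := mul_le_mul_of_nonneg_left hreg hmu.le
  rw [← fTilde_add (K := K) (lam := lam) (mu := mu) (f := f) w',
    ← fTilde_add (K := K) (lam := lam) (mu := mu) (f := f) w]
  linarith

/-- Quadratic growth of a linear function plus a multiple of the regularizer. -/
theorem IsGaugeSet.growth_of_isMinOn (hlam : 0 < lam) (hK : IsGaugeSet lam K)
    (hd : Differentiable ℝ fun x : Vec d => gauge K x ^ 2) {ζ v p : Vec d} {M : ℝ}
    (hM : 0 ≤ M) (hv : v ∈ K)
    (hmin : IsMinOn (fun p => inner ℝ ζ p + M * gaugeReg K lam p) K v) (hp : p ∈ K) :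
    inner ℝ ζ v + M * gaugeReg K lam v + M / 6 * gauge K (p - v) ^ 2 ≤
      inner ℝ ζ p + M * gaugeReg K lam p := by
  have hg : HasGradientAt (fun p => inner ℝ ζ p + M * gaugeReg K lam p)
      (ζ + M • (1 / lam) • gradient (fun x => gauge K x ^ 2) v) v := by
    rw [hasGradientAt_iff_hasFDerivAt, map_add, map_smul _ M]
    exact (InnerProductSpace.toDual ℝ (Vec d) ζ : Vec d →L[ℝ] ℝ).hasFDerivAt.add
      ((hasGradientAt_gaugeReg hd v).hasFDerivAt.const_mul M)
  have h1 := inner_nonneg_of_isMinOn hK.convex hg hmin hv hp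
  rw [inner_add_left, inner_sub_right, real_inner_smul_left, real_inner_smul_left] at h1
  have h2 := mul_le_mul_of_nonneg_left (hK.bregman_gauge_sq_ge hd hlam v p)
    (show 0 ≤ M * (1 / lam) by positivity)
  have e : M * (1 / lam) * (lam / 6 * gauge K (p - v) ^ 2) = M / 6 * gauge K (p - v) ^ 2 := by
    field_simp
  rw [e] at h2
  simp only [bregman, gaugeReg] at h2 ⊢
  linarith

theorem IsGaugeSet.gauge_sub_sq_le (hlam : 0 < lam) (hK : IsGaugeSet lam K)
    (hd : Differentiable ℝ fun x : Vec d => gauge K x ^ 2) {x z : Vec d} (hx : x ∈ K)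
    (hz : z ∈ K) : gauge K (x - z) ^ 2 ≤ 2 + 8 / lam := by
  have h1 := hK.gauge_add_le x (-z)
  rw [← sub_eq_add_neg] at h1
  have hx1 := hK.gauge_le_one_iff.2 hx
  have hz1 : gauge K z ^ 2 ≤ 1 := pow_le_one₀ (gauge_nonneg _) (hK.gauge_le_one_iff.2 hz)
  have h2 := hK.gauge_neg_sq_le hd hlam z
  have h3 : gauge K (-z) ^ 2 ≤ 4 / lam := by
    rw [le_div_iff₀ hlam]; linarith
  have h4 := pow_le_pow_left₀ (gauge_nonneg _)
    (h1.trans (add_le_add hx1 (le_refl (gauge K (-z))))) 2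
  have e : 8 / lam = 2 * (4 / lam) := by ring
  rw [e]
  linarith [sq_nonneg (1 - gauge K (-z))]

/-- Upper and lower models of `f` at the origin, where `∇φ` vanishes, give `μ/λ ≤ L/2`; then `λ ≤
2`. -/
theorem IsGaugeSet.le_of_isRelStronglyConvexOn (hlam : 0 < lam) (hL : 0 < L)
    (hK : IsGaugeSet lam K)
    (hd : Differentiable ℝ fun x : Vec d => gauge K x ^ 2) (hf : IsSmooth K f L)
    (hs : IsRelStronglyConvexOn K (gaugeReg K lam) f mu) {v : Vec d} (hv : v ≠ 0) :
    mu ≤ L := by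
  have hu : (gauge K v)⁻¹ • v ≠ 0 := smul_ne_zero (inv_ne_zero (hK.gauge_pos.2 hv).ne') hv
  have h1 := hs _ (hK.smul_inv_gauge_mem v) 0 hK.zero_mem
  have h2 := hf.le_quadratic hK ((gauge K v)⁻¹ • v) 0
  set u := (gauge K v)⁻¹ • v
  rw [bregman_gaugeReg hd] at h1
  simp only [bregman, gradient_gauge_sq_zero hd, gauge_zero, sub_zero, inner_zero_left] at h1 h2
  have h3 : mu / lam * gauge K u ^ 2 ≤ L / 2 * gauge K u ^ 2 := by
    have e : mu * (1 / lam * (gauge K u ^ 2 - 0 ^ 2)) = mu / lam * gauge K u ^ 2 := by ring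
    rw [e] at h1
    linarith
  have h4 := le_of_mul_le_mul_right h3 (pow_pos (hK.gauge_pos.2 hu) 2)
  rw [div_le_iff₀ hlam] at h4
  have := hK.le_two hd hlam hv
  nlinarith

theorem IsGaugeSet.two_le_of_isSmooth (hK : IsGaugeSet lam K)
    (hN : IsSmooth K (fun x : Vec d => gauge K x ^ 2) Lphi) {v : Vec d} (hv : v ≠ 0) :
    2 ≤ Lphi := by
  have h := hN.le_quadratic hK v 0
  simp only [gradient_gauge_sq_zero hN.1, gauge_zero, sub_zero, inner_zero_left] at h
  have := pow_pos (hK.gauge_pos.2 hv) 2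
  by_contra! hlt
  nlinarith

/-- Here the value of `Lphi` enters: this bound gives `β ≤ 1/2` and the room needed in the induction
step. -/
theorem IsGaugeSet.two_le_one_add (hlam : 0 < lam) (hK : IsGaugeSet lam K)
    (hN : IsSmooth K (fun x : Vec d => gauge K x ^ 2) Lphi) {v : Vec d} (hv : v ≠ 0) :
    2 ≤ 1 + Lphi / lam := by
  have h1 := hK.two_le_of_isSmooth hN hv
  have h2 := hK.le_two hN.1 hlam hv
  have : 1 ≤ Lphi / lam := by rw [le_div_iff₀ hlam]; linarith
  linarith

theorem stepRatio_nonneg : 0 ≤ stepRatio lam Lphi L mu := by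
  unfold stepRatio; positivity

theorem stepRatio_sq (hL : 0 < L) (hmu : 0 < mu) (hq : 0 < 1 + Lphi / lam) :
    L * stepRatio lam Lphi L mu ^ 2 = mu / (4 * (1 + Lphi / lam)) := by
  unfold stepRatio
  rw [mul_pow, Real.sq_sqrt (by positivity)]
  field_simp; norm_num

theorem stepRatio_le_half (hL : 0 < L) (hq : 2 ≤ 1 + Lphi / lam)
    (h : mu ≤ L) : stepRatio lam Lphi L mu ≤ 1 / 2 := by
  have h1 : √(mu / (L * (1 + Lphi / lam))) ≤ 1 := by
    rw [Real.sqrt_le_one]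
    refine (div_le_one (by positivity)).2 ?_
    nlinarith
  unfold stepRatio
  linarith

end Objective

/-! ### Weights -/

section Weights

variable {lam Lphi L mu : ℝ} {T : ℕ} {α : ℕ → ℝ}

theorem cumWeight_one : cumWeight α 1 = α 1 := by simp [cumWeight]

theorem sum_Icc_pred_add {M : Type*} [AddCommMonoid M] (g : ℕ → M) {t : ℕ} (ht : 1 ≤ t) :
    ∑ s ∈ Finset.Icc 1 (t - 1), g s + g t = ∑ s ∈ Finset.Icc 1 t, g s := by
  obtain ⟨k, rfl⟩ := Nat.exists_eq_add_of_le' ht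
  rw [Finset.sum_Icc_succ_top (by omega)]; simp

theorem cumWeight_pred_add {t : ℕ} (ht : 1 ≤ t) :
    cumWeight α (t - 1) + α t = cumWeight α t := sum_Icc_pred_add α ht

theorem IsWeightSeq.cumWeight_pos (hw : IsWeightSeq lam Lphi L mu T α) {t : ℕ} (h1 : 1 ≤ t)
    (hT : t ≤ T) : 0 < cumWeight α t := by
  refine Finset.sum_pos (fun s hs => ?_) ⟨1, by simpa using h1⟩
  rw [Finset.mem_Icc] at hs
  exact hw.2.1 s hs.1 (hs.2.trans hT)

theorem IsWeightSeq.weight_eq (hw : IsWeightSeq lam Lphi L mu T α) {t : ℕ} (h2 : 2 ≤ t)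
    (hT : t ≤ T) : α t = stepRatio lam Lphi L mu * cumWeight α t := by
  rw [← hw.2.2 t h2 hT, div_mul_cancel₀ _ (hw.cumWeight_pos (by omega) hT).ne']

theorem IsWeightSeq.cumWeight_pred (hw : IsWeightSeq lam Lphi L mu T α) {t : ℕ} (h2 : 2 ≤ t)
    (hT : t ≤ T) : cumWeight α (t - 1) = (1 - stepRatio lam Lphi L mu) * cumWeight α t := by
  have h := cumWeight_pred_add (α := α) (t := t) (by omega)
  rw [hw.weight_eq h2 hT] at h
  linarith

/-- Iterates `A_{t-1} = (1 - β) A_t ≤ e^{-β} A_t`. -/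
theorem IsWeightSeq.weight_one_le (hw : IsWeightSeq lam Lphi L mu T α)
    {t : ℕ} (h1 : 1 ≤ t) (hT : t ≤ T) :
    α 1 ≤ Real.exp (-(stepRatio lam Lphi L mu * (t - 1))) * cumWeight α t := by
  induction t, h1 using Nat.le_induction with
  | base => simp [cumWeight_one]
  | succ t ht ih =>
    refine (ih (by omega)).trans ?_
    have h := hw.cumWeight_pred (t := t + 1) (by omega) hT
    rw [Nat.add_sub_cancel] at h
    have hA := hw.cumWeight_pos (t := t + 1) (by omega) hT
    rw [h, ← mul_assoc]
    refine mul_le_mul_of_nonneg_right ?_ hA.le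
    have e : -(stepRatio lam Lphi L mu * (((t + 1 : ℕ) : ℝ) - 1)) =
        -(stepRatio lam Lphi L mu * (t - 1)) + -stepRatio lam Lphi L mu := by
      push_cast; ring
    rw [e, Real.exp_add]
    exact mul_le_mul_of_nonneg_left (Real.one_sub_le_exp_neg _) (Real.exp_pos _).le

end Weights

/-! ### Convergence by an estimate sequence -/

section Estimate

variable {lam Lphi L mu : ℝ} {K : Set (Vec d)} {f : Vec d → ℝ} {α : ℕ → ℝ}
  {z v w : ℕ → Vec d}

/-- The estimate function `∑_{s ≤ t} α_s (f̃(z_s) + ⟨∇f̃(z_s), p - z_s⟩ + μ φ(p)) + φ(p)`. -/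
noncomputable def estimateFn (K : Set (Vec d)) (lam mu : ℝ) (f : Vec d → ℝ) (α : ℕ → ℝ) (z : ℕ → Vec d)
    (t : ℕ) (p : Vec d) : ℝ :=
  ∑ s ∈ Finset.Icc 1 t, α s * (fTilde K lam mu f (z s) +
    inner ℝ (gradient (fTilde K lam mu f) (z s)) (p - z s) + mu * gaugeReg K lam p) +
  gaugeReg K lam p

theorem estimateFn_eq (t : ℕ) (p : Vec d) :
    estimateFn K lam mu f α z t p =
      inner ℝ (gradSum K lam mu f α z t) p + (1 + mu * cumWeight α t) * gaugeReg K lam p +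
      ∑ s ∈ Finset.Icc 1 t, α s * (fTilde K lam mu f (z s) -
        inner ℝ (gradient (fTilde K lam mu f) (z s)) (z s)) := by
  simp only [estimateFn, gradSum, cumWeight, sum_inner, real_inner_smul_left]
  have e : (1 + mu * ∑ s ∈ Finset.Icc 1 t, α s) * gaugeReg K lam p =
      ∑ s ∈ Finset.Icc 1 t, α s * (mu * gaugeReg K lam p) + gaugeReg K lam p := by
    rw [← Finset.sum_mul]; ring
  have e2 : ∀ a b c g : ℝ, a + (b + g) + c = (a + b + c) + g := fun a b c g => by ring
  rw [e, e2, ← Finset.sum_add_distrib, ← Finset.sum_add_distrib]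
  congr 1
  refine Finset.sum_congr rfl fun s _ => ?_
  rw [inner_sub_right]; ring

theorem estimateFn_succ {t : ℕ} (ht : 1 ≤ t) (p : Vec d) :
    estimateFn K lam mu f α z t p = estimateFn K lam mu f α z (t - 1) p +
      α t * (fTilde K lam mu f (z t) +
        inner ℝ (gradient (fTilde K lam mu f) (z t)) (p - z t) + mu * gaugeReg K lam p) := by
  unfold estimateFn
  rw [← sum_Icc_pred_add _ ht]
  ring

/-- The engine shared by both forms. They start differently, so the recursions are required only
from `t = 2` and the first round enters through `B`. -/
theorem objective_sub_le_of_scheme (hlam : 0 < lam) (hL : 0 < L) (hmu : 0 < mu)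
    (hK : IsGaugeSet lam K) (hN : IsSmooth K (fun x : Vec d => gauge K x ^ 2) Lphi)
    (hf : IsSmooth K f L) (hs : IsRelStronglyConvexOn K (gaugeReg K lam) f mu)
    {u : Vec d} (hu : u ≠ 0) {T : ℕ} (hT : 1 ≤ T) (hα : IsWeightSeq lam Lphi L mu T α)
    (hvK : ∀ t, 1 ≤ t → t ≤ T → v t ∈ K)
    (hmin : ∀ t, 1 ≤ t → t ≤ T → IsMinOn (fun p => inner ℝ (gradSum K lam mu f α z t) p +
      (1 + mu * cumWeight α t) * gaugeReg K lam p) K (v t))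
    (hz1 : z 1 ∈ K) (hw1 : w 1 ∈ K)
    (hz : ∀ t, 2 ≤ t → t ≤ T → z t =
      (1 - stepRatio lam Lphi L mu) • w (t - 1) + stepRatio lam Lphi L mu • v (t - 1))
    (hw : ∀ t, 2 ≤ t → t ≤ T → w t =
      (1 - stepRatio lam Lphi L mu) • w (t - 1) + stepRatio lam Lphi L mu • v t)
    {B : ℝ} (hB0 : 0 ≤ B) (hB : f (w 1) ≤ fTilde K lam mu f (z 1) +
      inner ℝ (gradient (fTilde K lam mu f) (z 1)) (v 1 - z 1) + mu * gaugeReg K lam (v 1) + B)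
    {p : Vec d} (hp : p ∈ K) :
    f (w T) - f p ≤
      Real.exp (-(stepRatio lam Lphi L mu * (T - 1))) * (B + 1 / (lam * α 1)) := by
  have hq := hK.two_le_one_add hlam hN hu
  have hb0 : 0 ≤ stepRatio lam Lphi L mu := stepRatio_nonneg
  have hb : stepRatio lam Lphi L mu ≤ 1 / 2 :=
    stepRatio_le_half hL hq (hK.le_of_isRelStronglyConvexOn hlam hL hN.1 hf hs hu)
  have hbsq := stepRatio_sq hL hmu (show 0 < 1 + Lphi / lam by linarith)
  have hα1 := hα.2.1 1 le_rfl hT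
  set β := stepRatio lam Lphi L mu
  have hwK : ∀ t, 1 ≤ t → t ≤ T → w t ∈ K := fun t ht => by
    induction t, ht using Nat.le_induction with
    | base => exact fun _ => hw1
    | succ t ht ih =>
      intro htT
      rw [hw (t + 1) (by omega) htT]
      exact hK.convex (ih (by omega)) (hvK _ (by omega) htT) (by linarith) hb0 (by ring)
  have hzK : ∀ t, 1 ≤ t → t ≤ T → z t ∈ K := fun t ht htT => by
    rcases ht.eq_or_lt with rfl | ht2
    · exact hz1
    · rw [hz t ht2 htT]
      exact hK.convex (hwK _ (by omega) (by omega)) (hvK _ (by omega) (by omega))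
        (by linarith) hb0 (by ring)
  have hest : ∀ t, 1 ≤ t → t ≤ T →
      cumWeight α t * f (w t) ≤ estimateFn K lam mu f α z t (v t) + α 1 * B := fun t ht => by
    induction t, ht using Nat.le_induction with
    | base =>
      intro _
      have h1 := mul_le_mul_of_nonneg_left hB hα1.le
      have h2 := gaugeReg_nonneg (K := K) hlam (v 1)
      rw [cumWeight_one]
      simp only [estimateFn, Finset.Icc_self, Finset.sum_singleton]
      linarith
    | succ t ht ih =>
      intro htT
      have hIH := ih (by omega)
      have hA := hα.cumWeight_pos (t := t + 1) (by omega) htT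
      have hA' := hα.cumWeight_pos ht (by omega)
      have hpred := hα.cumWeight_pred (t := t + 1) (by omega) htT
      have hwt := hα.weight_eq (t := t + 1) (by omega) htT
      have hsucc := estimateFn_succ (K := K) (lam := lam) (mu := mu) (f := f) (α := α) (z := z)
        (t := t + 1) (by omega) (v (t + 1))
      have hzt := hz (t + 1) (by omega) htT
      have hwt' := hw (t + 1) (by omega) htT
      rw [Nat.add_sub_cancel] at hpred hsucc hzt hwt'
      have hstep := hK.objective_step_le hlam hmu hN.1 hf hs hb0 (by linarith)
        (hwK t ht (by omega)) (hvK t ht (by omega)) hzt hwt'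
      have hgrow := hK.growth_of_isMinOn hlam hN.1 (by positivity) (hvK t ht (by omega))
        (hmin t ht (by omega)) (hvK (t + 1) (by omega) htT)
      rw [hsucc, hwt]
      rw [estimateFn_eq] at hIH ⊢
      have hm := mul_le_mul_of_nonneg_left hstep hA.le
      -- Error against growth: the left side is at most `μ A_{t+1} / 16`, and `A_t ≥ A_{t+1} / 2`
      -- makes the right side at least `μ A_{t+1} / 12`.
      have hcoef : cumWeight α (t + 1) * (L / 2 * β ^ 2) ≤ (1 + mu * cumWeight α t) / 6 := by
        have e1 : L / 2 * β ^ 2 ≤ mu / 16 := by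
          have : mu / (4 * (1 + Lphi / lam)) ≤ mu / (4 * 2) := by gcongr
          linarith
        rw [hpred]
        have h1 := mul_le_mul_of_nonneg_left e1 hA.le
        have h2 := mul_le_mul_of_nonneg_right (show (1 : ℝ) / 2 ≤ 1 - β by linarith)
          (mul_pos hmu hA).le
        have h3 := mul_pos hmu hA
        nlinarith
      have hfin := mul_le_mul_of_nonneg_right hcoef (sq_nonneg (gauge K (v (t + 1) - v t)))
      have e2 : cumWeight α (t + 1) * ((1 - β) * f (w t)) = cumWeight α t * f (w t) := by
        rw [hpred]; ring
      nlinarith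
  have hA := hα.cumWeight_pos hT le_rfl
  have h1 := hest T hT le_rfl
  have h2 : estimateFn K lam mu f α z T (v T) ≤ estimateFn K lam mu f α z T p := by
    rw [estimateFn_eq, estimateFn_eq]
    exact add_le_add (hmin T hT le_rfl hp) le_rfl
  have h3 : estimateFn K lam mu f α z T p ≤ cumWeight α T * f p + 1 / lam := by
    unfold estimateFn cumWeight
    rw [Finset.sum_mul]
    refine add_le_add (Finset.sum_le_sum fun s hs' => ?_) (hK.gaugeReg_le hlam hp)
    rw [Finset.mem_Icc] at hs'
    refine mul_le_mul_of_nonneg_left ?_ (hα.2.1 s hs'.1 hs'.2).le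
    rw [← fTilde_add (K := K) (lam := lam) (mu := mu) (f := f) p]
    exact add_le_add (hs.fTilde_le hN.1 hf.1 (hzK s hs'.1 hs'.2) hp) le_rfl
  have h4 : cumWeight α T * (f (w T) - f p) ≤ α 1 * (B + 1 / (lam * α 1)) := by
    have e : α 1 * (B + 1 / (lam * α 1)) = α 1 * B + 1 / lam := by field_simp
    rw [e]; linarith
  have h5 := mul_le_mul_of_nonneg_right (hα.weight_one_le hT le_rfl)
    (show 0 ≤ B + 1 / (lam * α 1) by positivity)
  refine le_of_mul_le_mul_left ?_ hA
  calc _ ≤ _ := h4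
    _ ≤ _ := h5
    _ = _ := by ring

end Estimate

section Runs

variable {lam Lphi L mu : ℝ} {K : Set (Vec d)} {f : Vec d → ℝ} {α : ℕ → ℝ}

/-! ### The iterative form -/

/-- A convex parabola is minimized on `[0,1]` at the projection of its vertex. -/
theorem quadratic_clip_le {s M r : ℝ} (hM : 0 < M) (h0 : 0 ≤ r) (h1 : r ≤ 1) :
    max 0 (min 1 (-(s / (2 * M)))) * s + M * max 0 (min 1 (-(s / (2 * M)))) ^ 2 ≤
      r * s + M * r ^ 2 := by
  obtain ⟨c, hc⟩ : ∃ c, c = -(s / (2 * M)) := ⟨_, rfl⟩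
  have hs : s = -(2 * M * c) := by rw [hc]; field_simp
  rw [← hc, hs]
  rcases le_total c 0 with h | h
  · rw [min_eq_right (by linarith), max_eq_left h]
    have : 0 ≤ M * r * (r - 2 * c) := mul_nonneg (mul_nonneg hM.le h0) (by linarith)
    linarith
  · rcases le_total c 1 with h' | h'
    · rw [min_eq_right h', max_eq_right h]
      nlinarith [mul_nonneg hM.le (sq_nonneg (r - c))]
    · rw [min_eq_left h', max_eq_right zero_le_one]
      have : 0 ≤ M * (1 - r) * (2 * c - 1 - r) :=
        mul_nonneg (mul_nonneg hM.le (by linarith)) (by linarith)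
      linarith

theorem IsGaugeSet.gauge_eq_one_iff (hK : IsGaugeSet lam K) {x : Vec d} :
    gauge K x = 1 ↔ x ∈ frontier K :=
  gauge_eq_one_iff_mem_frontier hK.convex hK.mem_nhds

/-- The clipped oracle answer minimizes the regularized linear function. -/
theorem IsGaugeSet.isMinOn_clip (hK : IsGaugeSet lam K) {ζ u : Vec d} {M : ℝ} (hM : 0 < M)
    (hu : u ∈ frontier K) (hmin : IsMinOn (fun p : Vec d => inner ℝ ζ p) (frontier K) u) :
    max 0 (min 1 (-(inner ℝ ζ u / (2 * M)))) • u ∈ K ∧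
    IsMinOn (fun p => inner ℝ ζ p + M * gauge K p ^ 2) K
      (max 0 (min 1 (-(inner ℝ ζ u / (2 * M)))) • u) := by
  set r := max 0 (min 1 (-(inner ℝ ζ u / (2 * M)))) with hr
  have hr0 : 0 ≤ r := le_max_left _ _
  have hr1 : r ≤ 1 := max_le zero_le_one (min_le_left _ _)
  have hg : gauge K (r • u) = r := by
    rw [gauge_smul_nonneg K hr0, hK.gauge_eq_one_iff.2 hu, mul_one]
  refine ⟨hK.gauge_le_one_iff.1 (hg.le.trans hr1), fun p hp => ?_⟩
  dsimp only [Set.mem_ofPred_eq]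
  rw [hg, real_inner_smul_right]
  refine (quadratic_clip_le hM (gauge_nonneg p) (hK.gauge_le_one_iff.2 hp)).trans
    (add_le_add ?_ le_rfl)
  by_cases hp0 : p = 0
  · simp [hp0]
  have hpos := hK.gauge_pos.2 hp0
  have hfr : (gauge K p)⁻¹ • p ∈ frontier K := by
    rw [← hK.gauge_eq_one_iff, gauge_smul_nonneg K (inv_nonneg.2 hpos.le),
      inv_mul_cancel₀ hpos.ne']
  have h := mul_le_mul_of_nonneg_left (hmin hfr) hpos.le
  dsimp only at h
  rw [real_inner_smul_right, mul_inv_cancel_left₀ hpos.ne'] at h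
  exact h

variable (hlam : 0 < lam) (hL : 0 < L) (hmu : 0 < mu) (hK : IsGaugeSet lam K)
  (hN : IsSmooth K (fun x : Vec d => gauge K x ^ 2) Lphi) (hf : IsSmooth K f L)
  (hs : IsRelStronglyConvexOn K (gaugeReg K lam) f mu) {u : Vec d} (hu : u ≠ 0)
  {T : ℕ} (hT : 1 ≤ T) {p : Vec d} (hp : p ∈ K)
include hlam hL hmu hK hN hf hs hu hT hp

theorem IsGaugeFWRun.sub_le {z zs v w : ℕ → Vec d}
    (hrun : IsGaugeFWRun K f lam Lphi L mu T α z zs v w) (hmin : IsMinOn f K p) :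
    f (w T) - f p ≤ Real.exp (-(stepRatio lam Lphi L mu * (T - 1))) *
      (f (w 0) - f p + L * (2 + 8 / lam) + 1 / (lam * α 1)) := by
  have hq := hK.two_le_one_add hlam hN hu
  have hb0 : 0 ≤ stepRatio lam Lphi L mu := stepRatio_nonneg
  have hb : stepRatio lam Lphi L mu ≤ 1 / 2 :=
    stepRatio_le_half hL hq (hK.le_of_isRelStronglyConvexOn hlam hL hN.1 hf hs hu)
  have hlead : ∀ t, 1 ≤ t → t ≤ T → v t ∈ K ∧
      IsMinOn (fun p => inner ℝ (gradSum K lam mu f α z t) p +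
        (1 + mu * cumWeight α t) * gaugeReg K lam p) K (v t) := fun t h1 h2 => by
    have hA := hrun.weights.cumWeight_pos h1 h2
    have h := hK.isMinOn_clip (M := (1 / mu + cumWeight α t) * (mu / lam)) (by positivity)
      (hrun.oracle_mem t h1 h2) (hrun.oracle_min t h1 h2)
    rw [← mul_assoc, ← hrun.step t h1 h2] at h
    have e : ∀ p : Vec d, (1 + mu * cumWeight α t) * gaugeReg K lam p =
        (1 / mu + cumWeight α t) * (mu / lam) * gauge K p ^ 2 := fun p => by
      unfold gaugeReg; field_simp
    simpa only [e] using h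
  have hw0 := hrun.init_mem
  have hv0 : v 0 ∈ K := hrun.init_eq ▸ hw0
  have hz1 := hrun.query 1 le_rfl hT
  have hw1 := hrun.average 1 le_rfl hT
  rw [Nat.sub_self] at hz1 hw1
  have hv1 := (hlead 1 le_rfl hT).1
  have hΔ : 0 ≤ f (w 0) - f p := sub_nonneg.2 (hmin hw0)
  refine objective_sub_le_of_scheme hlam hL hmu hK hN hf hs hu hT hrun.weights
    (fun t h1 h2 => (hlead t h1 h2).1) (fun t h1 h2 => (hlead t h1 h2).2)
    (hz1 ▸ hK.convex hw0 hv0 (by linarith) hb0 (by ring))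
    (hw1 ▸ hK.convex hw0 hv1 (by linarith) hb0 (by ring))
    (fun t h1 h2 => hrun.query t (by omega) h2) (fun t h1 h2 => hrun.average t (by omega) h2)
    (by positivity) ?_ hp
  have hstep := hK.objective_step_le hlam hmu hN.1 hf hs hb0 (by linarith) hw0 hv0 hz1 hw1
  have hz1' : z 1 = v 0 := by rw [hz1, hrun.init_eq]; module
  -- The step with `b = 1` bounds `f(v_1)`, hence `min f`, by the first model `ℓ` plus an error.
  -- This controls `f(w_0) - ℓ`, needed because `w_1` retains the share `1 - β` of `w_0`.
  have hdesc := hK.objective_step_le hlam hmu hN.1 hf hs zero_le_one le_rfl (v' := v 1) (z := z 1)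
    hw0 hv0 (by rw [hz1']; module) rfl
  have hdist := mul_le_mul_of_nonneg_left (hK.gauge_sub_sq_le hlam hN.1 hv1 hv0)
    (show 0 ≤ L / 2 by positivity)
  have e : (1 - (1 : ℝ)) • w 0 + (1 : ℝ) • v 1 = v 1 := by module
  rw [e] at hdesc
  have hle : f p ≤ f (v 1) := hmin hv1
  set ℓ := fTilde K lam mu f (z 1) +
      inner ℝ (gradient (fTilde K lam mu f) (z 1)) (v 1 - z 1) + mu * gaugeReg K lam (v 1)
  set β := stepRatio lam Lphi L mu
  have hD : 0 ≤ L / 2 * gauge K (v 1 - v 0) ^ 2 := by positivity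
  have h1 : (1 - β) * (f (w 0) - ℓ) ≤ f (w 0) - f p + L / 2 * gauge K (v 1 - v 0) ^ 2 := by
    have h2 : f (w 0) - ℓ ≤ f (w 0) - f p + L / 2 * gauge K (v 1 - v 0) ^ 2 := by linarith
    have h3 := mul_le_mul_of_nonneg_left h2 (show 0 ≤ 1 - β by linarith)
    nlinarith [mul_nonneg hb0 (add_nonneg hΔ hD)]
  have h2 : L / 2 * β ^ 2 * gauge K (v 1 - v 0) ^ 2 ≤ L / 2 * gauge K (v 1 - v 0) ^ 2 := by
    have : β ^ 2 ≤ 1 := pow_le_one₀ hb0 (by linarith)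
    nlinarith
  linarith

end Runs

/-! ### The game form -/

section Game

variable {lam Lphi L mu : ℝ} {K : Set (Vec d)} {f : Vec d → ℝ} {α : ℕ → ℝ}

theorem IsGaugeSet.midpoint_mem_interior (hlam : 0 < lam) (hK : IsGaugeSet lam K)
    {x z : Vec d} (hx : x ∈ K) (hz : z ∈ K) (hne : x ≠ z) :
    ((1 : ℝ) / 2) • x + ((1 : ℝ) - 1 / 2) • z ∈ interior K := by
  rw [← gauge_lt_one_iff_mem_interior hK.convex hK.mem_nhds]
  have h := hK.gauge_combo_le_one hlam hx hz (θ := 1 / 2) (by norm_num) (by norm_num)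
  have h1 := pow_pos (hK.gauge_pos.2 (sub_ne_zero.2 hne)) 2
  have := mul_pos hlam h1
  linarith

theorem hasGradientAt_sub_inner {h : Vec d → ℝ} {g x : Vec d} (hg : HasGradientAt h g x)
    (y : Vec d) : HasGradientAt (fun p => h p - inner ℝ y p) (g - y) x := by
  rw [hasGradientAt_iff_hasFDerivAt, map_sub]
  exact hg.hasFDerivAt.sub (InnerProductSpace.toDual ℝ (Vec d) y : Vec d →L[ℝ] ℝ).hasFDerivAt

/-- On a strictly convex set a convex differentiable function has the same gradient at any two
points where it is supported by the same affine function. -/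
theorem IsGaugeSet.gradient_eq_of_common_support (hlam : 0 < lam) (hK : IsGaugeSet lam K)
    {h : Vec d → ℝ} (hd : Differentiable ℝ h)
    (hconv : ∀ x ∈ K, ∀ z ∈ K, h x + inner ℝ (gradient h x) (z - x) ≤ h z)
    {a b : Vec d} (ha : a ∈ K) (hb : b ∈ K)
    (hab : h b ≤ h a + inner ℝ (gradient h a) (b - a)) : gradient h a = gradient h b := by
  by_cases hne : a = b
  · rw [hne]
  have hm := hK.midpoint_mem_interior hlam ha hb hne
  set m := ((1 : ℝ) / 2) • a + ((1 : ℝ) - 1 / 2) • b with hm'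
  have hmK : m ∈ K := interior_subset hm
  have support : ∀ c ∈ K, h m ≤ h c + inner ℝ (gradient h c) (m - c) →
      gradient h m = gradient h c := fun c hc hle => by
    refine sub_eq_zero.1 (eq_zero_of_isMinOn_of_mem_interior
      (hasGradientAt_sub_inner (hd m).hasGradientAt (gradient h c)) (fun p hp => ?_) hm)
    have := hconv c hc p hp
    rw [inner_sub_right] at this hle
    dsimp only [Set.mem_ofPred_eq]
    linarith
  have e1 : m - a = ((1 : ℝ) / 2) • (b - a) := by rw [hm']; module
  have e2 : m - b = (-(1 : ℝ) / 2) • (b - a) := by rw [hm']; module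
  have e3 : a - m = (-(1 : ℝ) / 2) • (b - a) := by rw [hm']; module
  have e4 : b - m = ((1 : ℝ) / 2) • (b - a) := by rw [hm']; module
  have hma := hconv m hmK a ha
  have hmb := hconv m hmK b hb
  rw [e3, real_inner_smul_right] at hma
  rw [e4, real_inner_smul_right] at hmb
  -- The tangent inequalities at `m` sum to `2 h(m) ≤ h(a) + h(b)`, so `m` lies on the supporting
  -- plane at `a`.
  have h1 : gradient h m = gradient h a := support a ha (by
    rw [e1, real_inner_smul_right]; linarith)
  have h2 : gradient h m = gradient h b := support b hb (by
    have h3 := hconv a ha m hmK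
    rw [e1, real_inner_smul_right] at h3
    -- `b` may lie on the boundary, so this yields only a variational inequality for `∇h(b) -
    -- ∇h(a)`; tested towards `m`, it puts `m` on the supporting plane at `b`.
    have hmin : IsMinOn (fun p => h p - inner ℝ (gradient h a) p) K b := fun p hp => by
      have := hconv a ha p hp
      rw [inner_sub_right] at this hab
      dsimp only [Set.mem_ofPred_eq]
      linarith
    have h4 := inner_nonneg_of_isMinOn hK.convex
      (hasGradientAt_sub_inner (hd b).hasGradientAt (gradient h a)) hmin hb hmK
    rw [inner_sub_left, e2, real_inner_smul_right, real_inner_smul_right] at h4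
    rw [e2, real_inner_smul_right]
    rw [h1] at hma hmb
    linarith)
  rw [← h1, h2]

/-- Equality in Fenchel–Young: convexity makes `x` itself attain the supremum. -/
theorem conjOn_gradient {h : Vec d → ℝ}
    (hconv : ∀ x ∈ K, ∀ z ∈ K, h x + inner ℝ (gradient h x) (z - x) ≤ h z)
    {x : Vec d} (hx : x ∈ K) :
    conjOn K h (gradient h x) = inner ℝ x (gradient h x) - h x := by
  refine IsGreatest.csSup_eq ⟨⟨x, hx, rfl⟩, ?_⟩
  rintro _ ⟨z, hz, rfl⟩
  have := hconv x hx z hz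
  rw [inner_sub_right] at this
  simp only [real_inner_comm (gradient h x)]
  linarith

/-- A best response in the gradient space to a point of `K` is the gradient at that point. -/
theorem IsGaugeSet.eq_gradient_of_isMinOn (hlam : 0 < lam) (hK : IsGaugeSet lam K)
    {h : Vec d → ℝ} (hd : Differentiable ℝ h)
    (hconv : ∀ x ∈ K, ∀ z ∈ K, h x + inner ℝ (gradient h x) (z - x) ≤ h z)
    {x y : Vec d} (hx : x ∈ K) (hy : y ∈ gradSpace K h)
    (hmin : IsMinOn (fun y => conjOn K h y - inner ℝ x y) (gradSpace K h) y) :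
    y = gradient h x := by
  obtain ⟨a, ha, rfl⟩ := hy
  have h1 := hmin (show gradient h x ∈ gradSpace K h from ⟨x, hx, rfl⟩)
  dsimp only [Set.mem_ofPred_eq] at h1
  rw [conjOn_gradient hconv ha, conjOn_gradient hconv hx] at h1
  refine hK.gradient_eq_of_common_support hlam hd hconv ha hx ?_
  rw [inner_sub_right, real_inner_comm x, real_inner_comm a]
  linarith

/-- The point `(α_t x_{t-1} + ∑_{s < t} α_s x_s) / A_t` at which the optimistic leader evaluates
the gradient. -/
noncomputable def optimisticAvg (α : ℕ → ℝ) (x : ℕ → Vec d) (t : ℕ) : Vec d :=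
  (cumWeight α t)⁻¹ • (α t • x (t - 1) + ∑ s ∈ Finset.Icc 1 (t - 1), α s • x s)

/-- Up to a term free of `y`, the optimistic leader best-responds to one averaged point. -/
theorem oftl_objective_eq (x : ℕ → Vec d) {t : ℕ} (ht : 1 ≤ t) (hA : cumWeight α t ≠ 0)
    (y : Vec d) :
    α t * -payoff K lam mu f (x (t - 1)) y +
        ∑ s ∈ Finset.Icc 1 (t - 1), α s * -payoff K lam mu f (x s) y =
      cumWeight α t * (conjOn K (fTilde K lam mu f) y - inner ℝ (optimisticAvg α x t) y) -
        (α t * (mu / lam * gauge K (x (t - 1)) ^ 2) +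
          ∑ s ∈ Finset.Icc 1 (t - 1), α s * (mu / lam * gauge K (x s) ^ 2)) := by
  have e : ∀ s, α s * -payoff K lam mu f (x s) y =
      α s * conjOn K (fTilde K lam mu f) y - α s * inner ℝ (x s) y -
        α s * (mu / lam * gauge K (x s) ^ 2) := fun s => by unfold payoff; ring
  have e1 : inner ℝ (optimisticAvg α x t) y = (cumWeight α t)⁻¹ *
      (α t * inner ℝ (x (t - 1)) y + ∑ s ∈ Finset.Icc 1 (t - 1), α s * inner ℝ (x s) y) := by
    simp only [optimisticAvg, real_inner_smul_left, inner_add_left, sum_inner]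
  rw [mul_sub, e1, mul_inv_cancel_left₀ hA, ← cumWeight_pred_add ht,
    Finset.sum_congr rfl fun s _ => e s, Finset.sum_sub_distrib, Finset.sum_sub_distrib,
    ← Finset.sum_mul]
  unfold payoff cumWeight
  ring

theorem btrl_objective_eq (y : ℕ → Vec d) (t : ℕ) (p : Vec d) :
    (∑ s ∈ Finset.Icc 1 t, α s * payoff K lam mu f p (y s)) + 1 / 1 * gaugeReg K lam p =
      (inner ℝ (∑ s ∈ Finset.Icc 1 t, α s • y s) p +
        (1 + mu * cumWeight α t) * gaugeReg K lam p) -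
        ∑ s ∈ Finset.Icc 1 t, α s * conjOn K (fTilde K lam mu f) (y s) := by
  have e : ∀ s, α s * payoff K lam mu f p (y s) =
      α s * inner ℝ (y s) p - α s * conjOn K (fTilde K lam mu f) (y s) +
        α s * (mu * gaugeReg K lam p) := fun s => by
    unfold payoff gaugeReg; rw [real_inner_comm p]; ring
  rw [Finset.sum_congr rfl fun s _ => e s, Finset.sum_add_distrib, Finset.sum_sub_distrib,
    ← Finset.sum_mul, sum_inner]
  simp only [real_inner_smul_left, cumWeight]
  ring

/-- Taking `c = x_t` gives the recursion of the averages, `c = x_{t-1}` that of the query points. -/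
theorem IsWeightSeq.inv_smul_eq {T : ℕ} (hα : IsWeightSeq lam Lphi L mu T α)
    (x : ℕ → Vec d) (c : Vec d) {t : ℕ} (h2 : 2 ≤ t) (hT : t ≤ T) :
    (cumWeight α t)⁻¹ • (α t • c + ∑ s ∈ Finset.Icc 1 (t - 1), α s • x s) =
      (1 - stepRatio lam Lphi L mu) • weightedAvg α x (t - 1) +
        stepRatio lam Lphi L mu • c := by
  have hA := (hα.cumWeight_pos (by omega) hT).ne'
  have hA' := (hα.cumWeight_pos (t := t - 1) (by omega) (by omega)).ne'
  have e1 : (cumWeight α t)⁻¹ * α t = stepRatio lam Lphi L mu := by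
    rw [hα.weight_eq h2 hT]; field_simp
  have e2 : (cumWeight α t)⁻¹ = (1 - stepRatio lam Lphi L mu) * (cumWeight α (t - 1))⁻¹ := by
    have h := hα.cumWeight_pred h2 hT
    field_simp
    rw [h, mul_comm]
  rw [smul_add, smul_smul, e1, weightedAvg, smul_smul, ← e2, add_comm]

theorem IsWeightSeq.weightedAvg_eq {T : ℕ} (hα : IsWeightSeq lam Lphi L mu T α)
    (x : ℕ → Vec d) {t : ℕ} (h2 : 2 ≤ t) (hT : t ≤ T) :
    weightedAvg α x t = (1 - stepRatio lam Lphi L mu) • weightedAvg α x (t - 1) +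
      stepRatio lam Lphi L mu • x t := by
  rw [← hα.inv_smul_eq x (x t) h2 hT, weightedAvg,
    ← sum_Icc_pred_add (fun s => α s • x s) (by omega : 1 ≤ t), add_comm]

theorem weightedAvg_one (h : α 1 ≠ 0) (x : ℕ → Vec d) : weightedAvg α x 1 = x 1 := by
  simp [weightedAvg, cumWeight_one, smul_smul, h]

theorem optimisticAvg_one (h : α 1 ≠ 0) (x : ℕ → Vec d) : optimisticAvg α x 1 = x 0 := by
  simp [optimisticAvg, cumWeight_one, smul_smul, h]

variable (hlam : 0 < lam) (hL : 0 < L) (hmu : 0 < mu) (hK : IsGaugeSet lam K)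
  (hN : IsSmooth K (fun x : Vec d => gauge K x ^ 2) Lphi) (hf : IsSmooth K f L)
  (hs : IsRelStronglyConvexOn K (gaugeReg K lam) f mu) {u : Vec d} (hu : u ≠ 0)
  {T : ℕ} (hT : 1 ≤ T) {p : Vec d} (hp : p ∈ K)
include hlam hL hmu hK hN hf hs hu hT hp

theorem IsFenchelGameRun.sub_le {x y : ℕ → Vec d}
    (hrun : IsFenchelGameRun K f lam Lphi L mu T α x y) :
    f (weightedAvg α x T) - f p ≤ Real.exp (-(stepRatio lam Lphi L mu * (T - 1))) *
      (L * (2 + 8 / lam) + 1 / (lam * α 1)) := by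
  have hq := hK.two_le_one_add hlam hN hu
  have hb0 : 0 ≤ stepRatio lam Lphi L mu := stepRatio_nonneg
  have hb : stepRatio lam Lphi L mu ≤ 1 / 2 :=
    stepRatio_le_half hL hq (hK.le_of_isRelStronglyConvexOn hlam hL hN.1 hf hs hu)
  have hα := hrun.weights
  have hα1 := (hα.2.1 1 le_rfl hT).ne'
  have hxK : ∀ t, 1 ≤ t → t ≤ T → x t ∈ K := fun t h1 h2 => (hrun.xPlayer t h1 h2).1
  have hwK : ∀ t, 1 ≤ t → t ≤ T → weightedAvg α x t ∈ K := fun t ht => by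
    induction t, ht using Nat.le_induction with
    | base => exact fun _ => weightedAvg_one hα1 x ▸ hxK 1 le_rfl hT
    | succ t ht ih =>
      intro htT
      rw [hα.weightedAvg_eq x (by omega) htT]
      exact hK.convex (ih (by omega)) (hxK _ (by omega) htT) (by linarith) hb0 (by ring)
  have hzK : ∀ t, 1 ≤ t → t ≤ T → optimisticAvg α x t ∈ K := fun t ht htT => by
    rcases ht.eq_or_lt with rfl | ht2
    · exact optimisticAvg_one hα1 x ▸ hrun.init_mem
    · rw [optimisticAvg, hα.inv_smul_eq x _ ht2 htT]
      exact hK.convex (hwK _ (by omega) (by omega)) (hxK _ (by omega) (by omega))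
        (by linarith) hb0 (by ring)
  have hy : ∀ t, 1 ≤ t → t ≤ T →
      y t = gradient (fTilde K lam mu f) (optimisticAvg α x t) := fun t ht htT => by
    obtain ⟨hyt, hmin⟩ := hrun.yPlayer t ht htT
    have hA := hα.cumWeight_pos ht htT
    refine hK.eq_gradient_of_isMinOn hlam
      (fun x => (hasGradientAt_fTilde hN.1 hf.1 x).differentiableAt)
      (fun a ha b hb => hs.fTilde_le hN.1 hf.1 ha hb) (hzK t ht htT) hyt fun y' hy' => ?_
    have h := hmin hy'
    dsimp only [Set.mem_ofPred_eq] at h ⊢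
    rw [oftl_objective_eq x ht hA.ne', oftl_objective_eq x ht hA.ne'] at h
    exact le_of_mul_le_mul_left (by linarith) hA
  have hlead : ∀ t, 1 ≤ t → t ≤ T →
      IsMinOn (fun p => inner ℝ (gradSum K lam mu f α (optimisticAvg α x) t) p +
        (1 + mu * cumWeight α t) * gaugeReg K lam p) K (x t) := fun t ht htT p' hp' => by
    have h := (hrun.xPlayer t ht htT).2 hp'
    have e : gradSum K lam mu f α (optimisticAvg α x) t =
        ∑ s ∈ Finset.Icc 1 t, α s • y s := by
      refine Finset.sum_congr rfl fun s hs' => ?_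
      rw [Finset.mem_Icc] at hs'
      rw [hy s hs'.1 (hs'.2.trans htT)]
    dsimp only [Set.mem_ofPred_eq] at h ⊢
    rw [btrl_objective_eq, btrl_objective_eq] at h
    rw [e]
    linarith
  refine objective_sub_le_of_scheme (z := optimisticAvg α x) (v := x)
    (w := weightedAvg α x) hlam hL hmu hK hN hf hs hu hT hα hxK hlead
    (hzK 1 le_rfl hT) (hwK 1 le_rfl hT)
    (fun t h1 h2 => ?_) (fun t h1 h2 => hα.weightedAvg_eq x h1 h2) (by positivity) ?_ hp
  · rw [optimisticAvg, hα.inv_smul_eq x _ h1 h2]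
  rw [weightedAvg_one hα1, optimisticAvg_one hα1]
  have hx1 := hxK 1 le_rfl hT
  have hdesc := hK.objective_step_le hlam hmu hN.1 hf hs zero_le_one le_rfl (v' := x 1)
    (z := x 0) (w' := x 1) hrun.init_mem hrun.init_mem (by module)
    (by module : x 1 = (1 - (1 : ℝ)) • x 0 + (1 : ℝ) • x 1)
  have hdist := mul_le_mul_of_nonneg_left
    (hK.gauge_sub_sq_le hlam hN.1 hx1 hrun.init_mem) (show 0 ≤ L by positivity)
  have : 0 ≤ L * gauge K (x 1 - x 0) ^ 2 := by positivity
  linarith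

end Game

/-! ### The rate -/

theorem stepRatio_mul_eq {lam Lphi L mu : ℝ} (hlam : 0 < lam) (hLphi : 0 < Lphi) (hL : 0 < L)
    (hmu : 0 < mu) (T : ℝ) : stepRatio lam Lphi L mu * T =
      T / (2 * √(1 + Lphi / lam) * √(L / mu)) := by
  have hq : 0 < 1 + Lphi / lam := by positivity
  have e : mu / (L * (1 + Lphi / lam)) = ((1 + Lphi / lam) * (L / mu))⁻¹ := by field_simp
  unfold stepRatio
  rw [e, Real.sqrt_inv, Real.sqrt_mul hq.le]
  have := Real.sqrt_pos.2 hq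
  have := Real.sqrt_pos.2 (div_pos hL hmu)
  field_simp

end GaugeFW

theorem mainTheorem4 (lam Lphi L mu : ℝ) (hlam : 0 < lam) (hLphi : 0 < Lphi) (hL : 0 < L)
    (hmu : 0 < mu) :
    ∃ C : ℝ, 0 < C ∧
      ∀ (d : ℕ) (K : Set (GaugeFW.Vec d)) (f : GaugeFW.Vec d → ℝ),
        GaugeFW.IsGaugeSet lam K →
        GaugeFW.IsSmooth K (fun x => gauge K x ^ 2) Lphi →
        GaugeFW.IsSmooth K f L →
        GaugeFW.IsRelStronglyConvexOn K (GaugeFW.gaugeReg K lam) f mu →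
        ∃ wstar ∈ K, IsMinOn f K wstar ∧
          (∀ (T : ℕ) (α : ℕ → ℝ) (z zs v w : ℕ → GaugeFW.Vec d),
            GaugeFW.IsGaugeFWRun K f lam Lphi L mu T α z zs v w →
            f (w T) - f wstar ≤ C * (1 + (f (w 0) - f wstar)) *
              Real.exp (-((T : ℝ) / (2 * √(1 + Lphi / lam) * √(L / mu))))) ∧
          (∀ (T : ℕ) (α : ℕ → ℝ) (x y : ℕ → GaugeFW.Vec d), 1 ≤ T →
            GaugeFW.IsFenchelGameRun K f lam Lphi L mu T α x y →
            f (GaugeFW.weightedAvg α x T) - f wstar ≤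
              C * Real.exp (-((T : ℝ) / (2 * √(1 + Lphi / lam) * √(L / mu))))) := by
  set β := GaugeFW.stepRatio lam Lphi L mu with hβ
  have hβ0 : 0 ≤ β := GaugeFW.stepRatio_nonneg
  obtain ⟨B, hB⟩ : ∃ B, B = L * (2 + 8 / lam) + 1 / (lam * (1 / (2 * L * (1 + Lphi / lam)))) :=
    ⟨_, rfl⟩
  have hB0 : 0 < B := by rw [hB]; positivity
  -- Growth starts at the second weight; the lost factor `e^β` goes into the constant.
  have hexp (T : ℕ) : Real.exp (-(β * (T - 1))) = Real.exp β * Real.exp (-(β * T)) := by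
    rw [← Real.exp_add]; congr 1; ring
  have hC1 : 1 ≤ Real.exp β * (1 + B) := by
    have := Real.one_le_exp hβ0
    nlinarith
  refine ⟨Real.exp β * (1 + B), by positivity, fun d K f hK hN hf hs => ?_⟩
  obtain ⟨p, hp, hmin⟩ := hK.isCompact.exists_isMinOn ⟨0, hK.zero_mem⟩
    hf.1.continuous.continuousOn
  refine ⟨p, hp, hmin, fun T α z zs v w hrun => ?_, fun T α x y hT hrun => ?_⟩
  · rw [← GaugeFW.stepRatio_mul_eq hlam hLphi hL hmu, ← hβ]
    have hΔ : 0 ≤ f (w 0) - f p := sub_nonneg.2 (hmin hrun.init_mem)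
    -- Bounds such as `λ ≤ 2` need a nonzero vector; in dimension zero all points coincide and the
    -- gap is zero.
    by_cases hu : ∃ u : GaugeFW.Vec d, u ≠ 0
    · obtain ⟨u, hu⟩ := hu
      rcases T.eq_zero_or_pos with rfl | hT
      · have := mul_le_mul_of_nonneg_right hC1 (show 0 ≤ 1 + (f (w 0) - f p) by linarith)
        simp only [CharP.cast_eq_zero, mul_zero, neg_zero, Real.exp_zero, mul_one]
        linarith
      · have h := hrun.sub_le hlam hL hmu hK hN hf hs hu hT hp hmin
        rw [hrun.weights.1, add_assoc, ← hB, ← hβ, hexp] at h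
        have h2 : f (w 0) - f p + B ≤ (1 + B) * (1 + (f (w 0) - f p)) := by nlinarith
        have h3 := mul_le_mul_of_nonneg_left h2
          (show 0 ≤ Real.exp β * Real.exp (-(β * T)) by positivity)
        linarith
    · push Not at hu
      rw [hu (w T), hu p, sub_self]
      rw [hu p] at hΔ
      positivity
  · rw [← GaugeFW.stepRatio_mul_eq hlam hLphi hL hmu, ← hβ]
    by_cases hu : ∃ u : GaugeFW.Vec d, u ≠ 0
    · obtain ⟨u, hu⟩ := hu
      have h := hrun.sub_le hlam hL hmu hK hN hf hs hu hT hp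
      rw [hrun.weights.1, ← hB, ← hβ, hexp] at h
      have h3 : 0 ≤ Real.exp β * Real.exp (-(β * T)) := by positivity
      linarith
    · push Not at hu
      rw [hu (GaugeFW.weightedAvg α x T), hu p, sub_self]
      positivity
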